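/- Let $k>0$ and let $f_0\in C^1(\mathbb{R})$ be real-valued with $f_0'\in W^{1,1}(\mathbb{R})$. Here $W^{1,1}(\mathbb{R})$ is the space of complex-valued $f\in L^1(\mathbb{R})$ whose weak derivative $f'$ lies in $L^1(\mathbb{R})$, with norm $\|f\|_{1,1}=\|f\|_1+\|f'\|_1$. In $W^{1,1}(\mathbb{R})$ consider the operator $$(Tf)(v)=i v f(v)-i k^{-2} f_0'(v)\int_{\mathbb{R}} f(w)\,dw,\qquad D(T)=\{f\in W^{1,1}(\mathbb{R}) : vf\in W^{1,1}(\mathbb{R})\}$$ (for $k=1$ this is $Tf=ivf-if_0'\int f$). Let $\sigma(T)$ be the set of $\lambda\in\mathbb{C}$ such that $T-\lambda I$ has no bounded inverse defined on all of $W^{1,1}(\mathbb{R})$. Let $\sigma_p(T)$ be the set of $\lambda$ for which $T-\lambda I$ is not injective; $\sigma_r(T)$ the set of $\lambda$ for which $T-\lambda I$ is injective but its inverse is not densely defined (its range is not dense); and $\sigma_c(T)$ the set of $\lambda$ for which $T-\lambda I$ is injective and its inverse is densely defined but unbounded. For $u\in\mathbb{C}$ say that $\varepsilon(k,u)=0$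 if $v\mapsto f_0'(v)/(v-u)$ is Lebesgue integrable on $\mathbb{R}$ and $$1-k^{-2}\int_{\mathbb{R}}\frac{f_0'(v)}{v-u}\,dv=0 .$$ Then $\sigma(T)=\sigma_p(T)\cup\sigma_c(T)\cup\sigma_r(T)$, and: 1. Every $\lambda\in\sigma_p(T)$ is of the form $\lambda=iu$ with $u\in\mathbb{C}$ and $\varepsilon(k,u)=0$. Conversely, if $\varepsilon(k,u)=0$, and either $u\notin\mathbb{R}$, or $u\in\mathbb{R}$ and $f_0$ is $C^2$ near $u$ with $f_0''$ H\"older continuous at $u$ (that is, $|f_0''(v)-f_0''(u)|\le C|v-u|^{\alpha}$ for $v$ near $u$, with some $\alpha>0$ and some $C$), then $iu\in\sigma_p(T)$. In particular, if $f_0\in C^3(\mathbb{R})$, then $\sigma_p(T)=\{iu : u\in\mathbb{C},\ \varepsilon(k,u)=0\}$. 2. $\sigma_c(T)=\{iu : u\in\mathbb{R},\ iu\notin\sigma_p(T),\ f_0'(u)\neq 0\}$. 3. $\sigma_r(T)=\{iu : u\in\mathbb{R},\ iu\notin\sigma_p(T),\ f_0'(u)=0\}$. -/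

import Mathlib

open MeasureTheory Set
open scoped ContDiff

noncomputable section

namespace Vlasov

/-! ### The complex Sobolev space `W^{1,1}(ℝ)` -/

/-- `g` is a weak derivative of `f` on the real line. It is only used for integrable `f`, `g`, so
both integrals converge. -/
def HasWeakDeriv (f g : ℝ → ℂ) : Prop :=
  ∀ φ : ℝ → ℝ, ContDiff ℝ ∞ φ → HasCompactSupport φ →
    ∫ x, deriv φ x • f x = -∫ x, φ x • g x

/-- The function `f` belongs to `W^{1,1}(ℝ)`: it is integrable and has an integrable weak
derivative. -/
def MemW11 (f : ℝ → ℂ) : Prop :=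
  Integrable f ∧ ∃ g : ℝ → ℂ, Integrable g ∧ HasWeakDeriv f g

lemma integrable_smul_of_test {φ : ℝ → ℝ} (hφ : Continuous φ) (hc : HasCompactSupport φ)
    {f : ℝ → ℂ} (hf : Integrable f) : Integrable fun x => φ x • f x := by
  obtain ⟨C, hC⟩ := hφ.bounded_above_of_compact_support hc
  exact hf.bdd_smul C hφ.aestronglyMeasurable (Filter.Eventually.of_forall hC)

lemma integrable_deriv_smul_of_test {φ : ℝ → ℝ} (hφ : ContDiff ℝ ∞ φ) (hc : HasCompactSupport φ)
    {f : ℝ → ℂ} (hf : Integrable f) : Integrable fun x => deriv φ x • f x :=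
  integrable_smul_of_test (hφ.continuous_deriv (by norm_num)) hc.deriv hf

lemma HasWeakDeriv.congr {f g f₁ g₁ : ℝ → ℂ} (h : HasWeakDeriv f g) (hf : f =ᵐ[volume] f₁)
    (hg : g =ᵐ[volume] g₁) : HasWeakDeriv f₁ g₁ := by
  intro φ hφ hc
  have h1 : ∫ x, deriv φ x • f₁ x = ∫ x, deriv φ x • f x :=
    integral_congr_ae (by filter_upwards [hf] with x hx; rw [hx])
  have h2 : ∫ x, φ x • g₁ x = ∫ x, φ x • g x :=
    integral_congr_ae (by filter_upwards [hg] with x hx; rw [hx])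
  rw [h1, h2, h φ hφ hc]

lemma HasWeakDeriv.add {f g f₁ g₁ : ℝ → ℂ} (h : HasWeakDeriv f g) (h₁ : HasWeakDeriv f₁ g₁)
    (hf : Integrable f) (hg : Integrable g) (hf₁ : Integrable f₁) (hg₁ : Integrable g₁) :
    HasWeakDeriv (f + f₁) (g + g₁) := by
  intro φ hφ hc
  simp only [Pi.add_apply, smul_add]
  rw [integral_add (integrable_deriv_smul_of_test hφ hc hf)
      (integrable_deriv_smul_of_test hφ hc hf₁),
    integral_add (integrable_smul_of_test hφ.continuous hc hg)
      (integrable_smul_of_test hφ.continuous hc hg₁), h φ hφ hc, h₁ φ hφ hc, neg_add]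

lemma HasWeakDeriv.const_smul {f g : ℝ → ℂ} (h : HasWeakDeriv f g) (c : ℂ) :
    HasWeakDeriv (c • f) (c • g) := by
  intro φ hφ hc
  simp only [Pi.smul_apply, smul_comm _ c]
  rw [integral_smul, integral_smul, h φ hφ hc, smul_neg]

lemma HasWeakDeriv.zero : HasWeakDeriv 0 0 := by
  intro φ _ _
  simp

lemma MemW11.congr {f f₁ : ℝ → ℂ} (h : MemW11 f) (hf : f =ᵐ[volume] f₁) : MemW11 f₁ := by
  obtain ⟨h0, g, hg, hw⟩ := h
  exact ⟨h0.congr hf, g, hg, hw.congr hf (Filter.EventuallyEq.refl _ _)⟩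

lemma MemW11.add {f f₁ : ℝ → ℂ} (h : MemW11 f) (h₁ : MemW11 f₁) : MemW11 (f + f₁) := by
  obtain ⟨h0, g, hg, hw⟩ := h
  obtain ⟨h0₁, g₁, hg₁, hw₁⟩ := h₁
  exact ⟨h0.add h0₁, g + g₁, hg.add hg₁, hw.add hw₁ h0 hg h0₁ hg₁⟩

lemma MemW11.const_smul {f : ℝ → ℂ} (h : MemW11 f) (c : ℂ) : MemW11 (c • f) := by
  obtain ⟨h0, g, hg, hw⟩ := h
  exact ⟨h0.smul c, c • g, hg.smul c, hw.const_smul c⟩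

lemma MemW11.zero : MemW11 0 :=
  ⟨integrable_zero _ _ _, 0, integrable_zero _ _ _, HasWeakDeriv.zero⟩

/-- `L¹(ℝ; ℂ)`. -/
abbrev L1 : Type := Lp ℂ 1 (volume : Measure ℝ)

/-- `W^{1,1}(ℝ)` as a subspace of `L¹ × L¹` with norm `‖f‖₁ + ‖g‖₁`, an element being the pair of
a function and its weak derivative. -/
def sobolevSubmodule : Submodule ℂ (WithLp 1 (L1 × L1)) where
  carrier := {F | HasWeakDeriv F.fst F.snd}
  add_mem' {F G} hF hG := by
    exact (HasWeakDeriv.add hF hG (L1.integrable_coeFn _) (L1.integrable_coeFn _)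
      (L1.integrable_coeFn _) (L1.integrable_coeFn _)).congr
        (Lp.coeFn_add F.fst G.fst).symm (Lp.coeFn_add F.snd G.snd).symm
  zero_mem' := HasWeakDeriv.zero.congr (Lp.coeFn_zero ℂ 1 volume).symm
    (Lp.coeFn_zero ℂ 1 volume).symm
  smul_mem' c F hF := by
    exact (HasWeakDeriv.const_smul hF c).congr
      (Lp.coeFn_smul c F.fst).symm (Lp.coeFn_smul c F.snd).symm

/-- The space `W^{1,1}(ℝ)` with the norm `‖f‖_{1,1} = ‖f‖₁ + ‖f'‖₁`. -/
abbrev W11 : Type := ↥sobolevSubmodule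

/-- The function underlying an element of `W^{1,1}(ℝ)` (a representative of its class). -/
def W11.fn (F : W11) : ℝ → ℂ := F.1.fst

/-- The weak derivative of an element of `W^{1,1}(ℝ)`. -/
def W11.fn' (F : W11) : ℝ → ℂ := F.1.snd

lemma W11.integrable_fn (F : W11) : Integrable F.fn := L1.integrable_coeFn _

lemma W11.memW11 (F : W11) : MemW11 F.fn :=
  ⟨L1.integrable_coeFn _, F.fn', L1.integrable_coeFn _, F.2⟩

lemma W11.norm_eq (F : W11) : ‖F‖ = (∫ x, ‖F.fn x‖) + ∫ x, ‖F.fn' x‖ := by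
  have h : ‖F‖ = ‖F.1.fst‖ + ‖F.1.snd‖ := by
    rw [Submodule.coe_norm, WithLp.prod_norm_eq_add (by simp)]
    simp
  rw [h, L1.norm_eq_integral_norm, L1.norm_eq_integral_norm]
  rfl

lemma W11.fn_add (F G : W11) : (F + G).fn =ᵐ[volume] F.fn + G.fn := Lp.coeFn_add _ _

lemma W11.fn_smul (c : ℂ) (F : W11) : (c • F).fn =ᵐ[volume] c • F.fn := Lp.coeFn_smul _ _

lemma W11.fn_zero : (0 : W11).fn =ᵐ[volume] 0 := Lp.coeFn_zero _ _ _

/-- Weak derivatives are unique, so an element of `W^{1,1}(ℝ)` is determined by its function. -/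
lemma W11.ext_fn {F G : W11} (h : F.fn =ᵐ[volume] G.fn) : F = G := by
  have h1 : F.1.fst = G.1.fst := Lp.ext h
  have h2 : F.1.snd = G.1.snd := by
    refine Lp.ext ?_
    refine ae_eq_of_integral_contDiff_smul_eq (L1.integrable_coeFn _).locallyIntegrable
      (L1.integrable_coeFn _).locallyIntegrable ?_
    intro φ hφ hc
    have hF := F.2 φ hφ hc
    have hG := G.2 φ hφ hc
    rw [h1] at hF
    exact neg_injective (hF.symm.trans hG)
  apply Subtype.ext
  apply WithLp.ofLp_injective
  exact Prod.ext h1 h2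

/-- The element of `W^{1,1}(ℝ)` given by a function. -/
def MemW11.toW11 {f : ℝ → ℂ} (h : MemW11 f) : W11 :=
  ⟨WithLp.toLp 1 (h.1.toL1 f, h.2.choose_spec.1.toL1 h.2.choose),
    h.2.choose_spec.2.congr h.1.coeFn_toL1.symm h.2.choose_spec.1.coeFn_toL1.symm⟩

lemma MemW11.fn_toW11 {f : ℝ → ℂ} (h : MemW11 f) : h.toW11.fn =ᵐ[volume] f := h.1.coeFn_toL1

/-! ### The operator -/

lemma ofReal_mul_fn_add (F G : W11) :
    (fun v : ℝ => (v : ℂ) * (F + G).fn v) =ᵐ[volume]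
      (fun v : ℝ => (v : ℂ) * F.fn v) + fun v : ℝ => (v : ℂ) * G.fn v := by
  filter_upwards [W11.fn_add F G] with v hv
  simp [hv, mul_add]

lemma ofReal_mul_fn_smul (c : ℂ) (F : W11) :
    (fun v : ℝ => (v : ℂ) * (c • F).fn v) =ᵐ[volume] c • fun v : ℝ => (v : ℂ) * F.fn v := by
  filter_upwards [W11.fn_smul c F] with v hv
  simp [hv, mul_left_comm]

/-- The domain `{f ∈ W^{1,1} : v f ∈ W^{1,1}}`. -/
def velocityDomain : Submodule ℂ W11 where
  carrier := {F | MemW11 fun v : ℝ => (v : ℂ) * F.fn v}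
  add_mem' {F G} hF hG := (MemW11.add hF hG).congr (ofReal_mul_fn_add F G).symm
  zero_mem' := MemW11.zero.congr (by
    filter_upwards [W11.fn_zero] with v hv
    simp [hv])
  smul_mem' c F hF := (MemW11.const_smul hF c).congr (ofReal_mul_fn_smul c F).symm

/-- Multiplication by the velocity, `f ↦ v f`, with domain `{f ∈ W^{1,1} : v f ∈ W^{1,1}}`. -/
def velocityMul : W11 →ₗ.[ℂ] W11 where
  domain := velocityDomain
  toFun :=
    { toFun := fun F => MemW11.toW11 F.2
      map_add' := fun F G => W11.ext_fn <| by
        filter_upwards [MemW11.fn_toW11 (F + G).2, MemW11.fn_toW11 F.2, MemW11.fn_toW11 G.2,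
          W11.fn_add (MemW11.toW11 F.2) (MemW11.toW11 G.2), ofReal_mul_fn_add F.1 G.1]
          with v h1 h2 h3 h4 h5
        rw [h1, h4, Pi.add_apply, h2, h3]
        exact h5
      map_smul' := fun c F => W11.ext_fn <| by
        filter_upwards [MemW11.fn_toW11 (c • F).2, MemW11.fn_toW11 F.2,
          W11.fn_smul c (MemW11.toW11 F.2), ofReal_mul_fn_smul c F.1] with v h1 h2 h3 h4
        rw [h1, RingHom.id_apply, h3, Pi.smul_apply, h2]
        exact h4 }

/-- The functional `f ↦ ∫ f dv` on `W^{1,1}(ℝ)`. -/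
def integralFunctional : W11 →ₗ[ℂ] ℂ where
  toFun F := ∫ v, F.fn v
  map_add' F G := by
    rw [integral_congr_ae (W11.fn_add F G)]
    exact integral_add F.integrable_fn G.integrable_fn
  map_smul' c F := by
    rw [integral_congr_ae (W11.fn_smul c F)]
    exact integral_smul c F.fn

/-- The operator `T f = i v f - i k⁻² g ∫ f dv` in `W^{1,1}(ℝ)` with domain
`{f ∈ W^{1,1} : v f ∈ W^{1,1}}`, where `g ∈ W^{1,1}(ℝ)` (to be taken as `f₀'`). -/
def vlasovOperator (k : ℝ) (g : W11) : W11 →ₗ.[ℂ] W11 where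
  domain := velocityMul.domain
  toFun := Complex.I • velocityMul.toFun -
    (LinearMap.toSpanSingleton ℂ W11 ((Complex.I * ((k : ℂ) ^ 2)⁻¹) • g)) ∘ₗ
      integralFunctional ∘ₗ velocityMul.domain.subtype

lemma vlasovOperator_fn (k : ℝ) (g : W11) (F : (vlasovOperator k g).domain) :
    (vlasovOperator k g F).fn =ᵐ[volume] fun v : ℝ =>
      Complex.I * v * F.1.fn v - Complex.I * ((k : ℂ) ^ 2)⁻¹ * g.fn v * ∫ w, F.1.fn w := by
  have key : vlasovOperator k g F = Complex.I • MemW11.toW11 F.2 +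
      (-((∫ w, F.1.fn w) * (Complex.I * ((k : ℂ) ^ 2)⁻¹))) • g := by
    rw [neg_smul, ← sub_eq_add_neg, mul_smul]
    rfl
  rw [key]
  filter_upwards [W11.fn_add (Complex.I • MemW11.toW11 F.2)
      ((-((∫ w, F.1.fn w) * (Complex.I * ((k : ℂ) ^ 2)⁻¹))) • g),
    W11.fn_smul Complex.I (MemW11.toW11 F.2),
    W11.fn_smul (-((∫ w, F.1.fn w) * (Complex.I * ((k : ℂ) ^ 2)⁻¹))) g,
    MemW11.fn_toW11 F.2] with v h1 h2 h3 h4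
  rw [h1, Pi.add_apply, h2, h3, Pi.smul_apply, Pi.smul_apply, h4, smul_eq_mul, smul_eq_mul]
  ring

/-! ### The spectrum of an unbounded operator and its parts -/

section Spectrum

variable {E : Type*} [NormedAddCommGroup E] [NormedSpace ℂ E]

/-- `T - λ I`, on the domain of `T`. -/
def shifted (T : E →ₗ.[ℂ] E) (z : ℂ) : T.domain →ₗ[ℂ] E :=
  T.toFun - z • T.domain.subtype

/-- The spectrum: all `z` for which `T - z I` has no bounded inverse defined on all of `E`. -/
def spectrum (T : E →ₗ.[ℂ] E) : Set ℂ :=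
  {z | ¬ ∃ R : E →L[ℂ] E, (∀ x : T.domain, R (shifted T z x) = x) ∧
    ∀ y : E, ∃ x : T.domain, (x : E) = R y ∧ shifted T z x = y}

/-- The point spectrum: `T - z I` is not injective. -/
def pointSpectrum (T : E →ₗ.[ℂ] E) : Set ℂ :=
  {z | ¬ Function.Injective (shifted T z)}

/-- The residual spectrum: the resolvent `(T - z I)⁻¹` exists, but its domain, the range of
`T - z I`, is not dense. -/
def residualSpectrum (T : E →ₗ.[ℂ] E) : Set ℂ :=
  {z | Function.Injective (shifted T z) ∧ ¬ Dense (range (shifted T z))}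

/-- The continuous spectrum: the resolvent `(T - z I)⁻¹` exists and is densely defined, but it is
unbounded. -/
def continuousSpectrum (T : E →ₗ.[ℂ] E) : Set ℂ :=
  {z | Function.Injective (shifted T z) ∧ Dense (range (shifted T z)) ∧
    ¬ ∃ C : ℝ, ∀ x : T.domain, ‖(x : E)‖ ≤ C * ‖shifted T z x‖}

end Spectrum

/-! ### The dispersion relation -/

/-- The integrand `f₀'(v) / (v - u)` for complex `u`. -/
def dispersionIntegrand (f₀ : ℝ → ℝ) (u : ℂ) (v : ℝ) : ℂ := ((deriv f₀ v : ℝ) : ℂ) / ((v : ℂ) - u)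

/-- The relation `1 - k⁻² ∫ f₀'(v) / (v - u) dv = 0`, including the convergence of the integral. -/
def DispersionRelation (k : ℝ) (f₀ : ℝ → ℝ) (u : ℂ) : Prop :=
  Integrable (dispersionIntegrand f₀ u) ∧
    1 - ((k : ℂ) ^ 2)⁻¹ * ∫ v, dispersionIntegrand f₀ u v = 0

/-- `f₀` is of class `C²` near `u` and `f₀''` is Hölder continuous at `u`. -/
def HolderC2At (f₀ : ℝ → ℝ) (u : ℝ) : Prop :=
  ContDiffAt ℝ 2 f₀ u ∧ ∃ α > (0 : ℝ), ∃ C : ℝ, ∀ᶠ v in nhds u,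
    |deriv (deriv f₀) v - deriv (deriv f₀) u| ≤ C * |v - u| ^ α

end Vlasov

end

/-!
With `A_u f = i (v - u) f`, the operator `T - i u I` is the rank one perturbation
`f ↦ A_u f - (∫ f) h` with `h = i k⁻² f₀'`, and `A_u` is injective for every `u`. A rank one
perturbation of an injective operator fails to be injective exactly when some `f` satisfies
`A_u f = h` and `∫ f = 1`; here `f = k⁻² f₀' / (v - u)`, so this is the dispersion relation together
with `f₀' / (v - u) ∈ W^{1,1}(ℝ)`. For real `u`, integrability of this quotient forces `f₀'(u) = 0`,
and Hölder continuity of `f₀''` at `u` makes the derivative of the quotient integrable near `u`.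

If `u` is not real, `A_u` has a bounded inverse, hence so has `T - i u I` as soon as it is injective
(Sherman–Morrison). If `u` is real, the closure of the range of `A_u` consists of the functions
vanishing at `u`, and `f ↦ ∫ f` is not bounded relative to `A_u`. The latter puts `h` in the closure
of the range of `T - i u I`, which is therefore dense if `f₀'(u) ≠ 0` and consists of functions
vanishing at `u` otherwise. Finally `|∫ f| ≤ δ ‖f‖ + C_δ ‖A_u f‖` for every `δ > 0`, so a lower
bound for `T - i u I` would bound `f ↦ ∫ f` relative to `A_u`.
-/

noncomputable section

open Filter Topology Convolution

namespace Vlasov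

/-! ### Weak derivatives and primitives -/

section Primitive

variable {E : Type*} [NormedAddCommGroup E] [NormedSpace ℝ E]

/-- The primitive of an integrable function that vanishes at `-∞`: the absolutely continuous
representative of a function in `W^{1,1}(ℝ)` whose weak derivative is `g`. -/
def primitive (g : ℝ → E) (x : ℝ) : E := ∫ t in Iic x, g t

lemma norm_primitive_le {g : ℝ → E} (hg : Integrable g) (x : ℝ) :
    ‖primitive g x‖ ≤ ∫ t, ‖g t‖ :=
  (norm_integral_le_integral_norm _).trans
    (setIntegral_le_integral hg.norm (Eventually.of_forall fun _ => norm_nonneg _))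

lemma tendsto_primitive_atBot (g : ℝ → E) : Tendsto (primitive g) atBot (𝓝 0) :=
  tendsto_integral_Iic_zero tendsto_id

lemma primitive_eq_add_intervalIntegral {g : ℝ → E} (hg : Integrable g) (a x : ℝ) :
    primitive g x = primitive g a + ∫ t in a..x, g t := by
  rw [primitive, primitive,
    ← intervalIntegral.integral_Iic_sub_Iic hg.integrableOn hg.integrableOn, add_sub_cancel]

lemma continuous_primitive {g : ℝ → E} (hg : Integrable g) : Continuous (primitive g) := by
  rw [funext (primitive_eq_add_intervalIntegral hg 0)]
  exact continuous_const.add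
    (intervalIntegral.continuous_primitive (fun _ _ => hg.intervalIntegrable) 0)

lemma integral_smul_primitive [CompleteSpace E] {a : ℝ → ℝ} {g : ℝ → E}
    (ha : Integrable a) (hg : Integrable g) :
    ∫ x, a x • primitive g x = ∫ t, (∫ x in Ioi t, a x) • g t := by
  let G : ℝ → ℝ → E := fun x t => {p : ℝ × ℝ | p.2 ≤ p.1}.indicator (fun p => a p.1 • g p.2) (x, t)
  have hG : Integrable (Function.uncurry G) (volume.prod volume) :=
    (ha.smul_prod hg).indicator (measurableSet_le measurable_snd measurable_fst)
  have inner_left (x : ℝ) : ∫ t, G x t = a x • primitive g x := by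
    rw [primitive, ← integral_smul, ← integral_indicator measurableSet_Iic]
    rfl
  have inner_right (t : ℝ) : ∫ x, G x t = (∫ x in Ioi t, a x) • g t := by
    rw [← integral_Ici_eq_integral_Ioi, ← integral_smul_const,
      ← integral_indicator measurableSet_Ici]
    rfl
  simpa only [inner_left, inner_right] using integral_integral_swap hG

end Primitive

lemma HasWeakDeriv.const_add_primitive {g : ℝ → ℂ} (hg : Integrable g) (c : ℂ) :
    HasWeakDeriv (fun x => c + primitive g x) g := by
  intro φ hφ hc
  have hφ' : Integrable (deriv φ) :=
    (hφ.continuous_deriv (by norm_num)).integrable_of_hasCompactSupport hc.deriv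
  have hφ1 : ContDiff ℝ 1 φ := hφ.of_le (by norm_num)
  have integral_deriv : ∫ x, deriv φ x = 0 :=
    integral_eq_zero_of_hasDerivAt_of_integrable
      (fun x => (hφ.differentiable (by simp) x).hasDerivAt) hφ'
      (hφ.continuous.integrable_of_hasCompactSupport hc)
  have integrable_deriv_smul : Integrable fun x => deriv φ x • primitive g x :=
    hφ'.smul_bdd (∫ t, ‖g t‖) (continuous_primitive hg).aestronglyMeasurable
      (Eventually.of_forall (norm_primitive_le hg))
  simp only [smul_add]
  rw [integral_add (hφ'.smul_const c) integrable_deriv_smul,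
    integral_smul_const, integral_deriv, zero_smul, zero_add, integral_smul_primitive hφ' hg]
  simp only [hc.integral_Ioi_deriv_eq hφ1, neg_smul, integral_neg]

lemma HasWeakDeriv.of_hasDerivAt_off_countable {f g : ℝ → ℂ} {s : Set ℝ} (hs : s.Countable)
    (hf : Continuous f) (h : ∀ x ∉ s, HasDerivAt f (g x) x) (hg : Integrable g) :
    HasWeakDeriv f g := by
  suffices f = fun x => (f 0 - primitive g 0) + primitive g x by
    rw [this]
    exact .const_add_primitive hg _
  funext x
  rw [primitive_eq_add_intervalIntegral hg 0 x,
    integral_eq_of_hasDerivAt_off_countable f g hs hf.continuousOn (fun y hy => h y hy.2)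
      hg.intervalIntegrable]
  ring

lemma HasWeakDeriv.deriv_convolution {f g : ℝ → ℂ} (h : HasWeakDeriv f g) {φ : ℝ → ℝ}
    (hφ : ContDiff ℝ ∞ φ) (hc : HasCompactSupport φ) : deriv φ ⋆ f = φ ⋆ g := by
  funext x
  have key := h (fun t => φ (x - t)) (hφ.comp (contDiff_const.sub contDiff_id))
    (hc.comp_homeomorph (Homeomorph.subLeft x))
  simp only [deriv_comp_const_sub, neg_smul, integral_neg, neg_inj] at key
  rwa [convolution_lsmul_swap, convolution_lsmul_swap]

lemma tendsto_convolution_atBot {E E' F : Type*} [NormedAddCommGroup E] [NormedSpace ℝ E]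
    [NormedAddCommGroup E'] [NormedSpace ℝ E'] [NormedAddCommGroup F] [NormedSpace ℝ F]
    (L : E →L[ℝ] E' →L[ℝ] F) {a : ℝ → E} {b : ℝ → E'} (ha : Integrable a) (hb : Continuous b)
    {C : ℝ} (hC : ∀ x, ‖b x‖ ≤ C) (h₀ : Tendsto b atBot (𝓝 0)) :
    Tendsto (a ⋆[L] b) atBot (𝓝 0) := by
  suffices Tendsto (a ⋆[L] b) atBot (𝓝 (∫ t, L (a t) 0)) by simpa using this
  refine tendsto_integral_filter_of_dominated_convergence (fun t => ‖L‖ * ‖a t‖ * C)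
    (Eventually.of_forall fun x => L.aestronglyMeasurable_comp₂ ha.aestronglyMeasurable
      (by fun_prop)) (Eventually.of_forall fun x => Eventually.of_forall fun t => ?_)
    ((ha.norm.const_mul _).mul_const _) (Eventually.of_forall fun t => ?_)
  · exact (L.le_opNorm₂ _ _).trans (by gcongr; exact hC _)
  · exact ((L (a t)).continuous.tendsto 0).comp
      (h₀.comp (tendsto_atBot_add_const_right _ (-t) tendsto_id))

lemma HasWeakDeriv.convolution_eq_convolution_primitive {f g : ℝ → ℂ} (h : HasWeakDeriv f g)
    (hf : Integrable f) (hg : Integrable g) {φ : ℝ → ℝ} (hφ : ContDiff ℝ ∞ φ)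
    (hc : HasCompactSupport φ) : φ ⋆ f = φ ⋆ primitive g := by
  have hP := continuous_primitive hg
  have hPw : HasWeakDeriv (primitive g) g := by simpa using HasWeakDeriv.const_add_primitive hg 0
  have hφ1 : ContDiff ℝ 1 φ := hφ.of_le (by norm_num)
  obtain ⟨C, hC⟩ := hφ.continuous.bounded_above_of_compact_support hc
  have hasDerivAt_sub (x : ℝ) : HasDerivAt (φ ⋆ f - φ ⋆ primitive g) 0 x := by
    refine ((hc.hasDerivAt_convolution_left _ hφ1 hf.locallyIntegrable x).sub
      (hc.hasDerivAt_convolution_left _ hφ1 hP.locallyIntegrable x)).congr_deriv ?_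
    rw [h.deriv_convolution hφ hc, hPw.deriv_convolution hφ hc, sub_self]
  have tendsto_f : Tendsto (φ ⋆ f) atBot (𝓝 0) := by
    rw [← convolution_flip]
    exact tendsto_convolution_atBot _ hf hφ.continuous hC
      (hc.is_zero_at_infty.mono_left atBot_le_cocompact)
  have tendsto_primitive : Tendsto (φ ⋆ primitive g) atBot (𝓝 0) :=
    tendsto_convolution_atBot _ (hφ.continuous.integrable_of_hasCompactSupport hc) hP
      (norm_primitive_le hg) (tendsto_primitive_atBot g)
  funext x
  have eq_const : φ ⋆ f - φ ⋆ primitive g = fun _ => (φ ⋆ f - φ ⋆ primitive g) x :=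
    funext fun y => is_const_of_deriv_eq_zero (fun x => (hasDerivAt_sub x).differentiableAt)
      (fun x => (hasDerivAt_sub x).deriv) y x
  have tendsto_sub := tendsto_f.sub tendsto_primitive
  rw [sub_zero] at tendsto_sub
  change Tendsto (φ ⋆ f - φ ⋆ primitive g) atBot (𝓝 0) at tendsto_sub
  rw [eq_const] at tendsto_sub
  exact sub_eq_zero.1 (tendsto_nhds_unique tendsto_const_nhds tendsto_sub)

lemma HasWeakDeriv.ae_eq_primitive {f g : ℝ → ℂ} (h : HasWeakDeriv f g)
    (hf : Integrable f) (hg : Integrable g) : f =ᵐ[volume] primitive g := by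
  refine ae_eq_of_integral_contDiff_smul_eq hf.locallyIntegrable
    (continuous_primitive hg).locallyIntegrable fun φ hφ hc => ?_
  have := congrFun (h.convolution_eq_convolution_primitive hf hg (hφ.comp contDiff_neg)
    (hc.comp_homeomorph (Homeomorph.neg ℝ))) 0
  simpa [convolution_lsmul_swap] using this

lemma HasWeakDeriv.unique {f g₁ g₂ : ℝ → ℂ} (h₁ : HasWeakDeriv f g₁) (h₂ : HasWeakDeriv f g₂)
    (i₁ : LocallyIntegrable g₁) (i₂ : LocallyIntegrable g₂) : g₁ =ᵐ[volume] g₂ :=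
  ae_eq_of_integral_contDiff_smul_eq i₁ i₂
    fun φ hφ hc => neg_injective ((h₁ φ hφ hc).symm.trans (h₂ φ hφ hc))

/-! ### Multipliers of `W^{1,1}(ℝ)` -/

lemma integral_mul_eq_re_add_im {η : ℝ → ℂ} (hη : Continuous η) (hc : HasCompactSupport η)
    {f : ℝ → ℂ} (hf : Integrable f) :
    ∫ x, η x * f x = (∫ x, (η x).re • f x) + Complex.I * ∫ x, (η x).im • f x := by
  have integrable_re : Integrable fun x => (η x).re • f x :=
    integrable_smul_of_test (Complex.continuous_re.comp hη) (hc.comp_left Complex.zero_re) hf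
  have integrable_im : Integrable fun x => (η x).im • f x :=
    integrable_smul_of_test (Complex.continuous_im.comp hη) (hc.comp_left Complex.zero_im) hf
  rw [← integral_const_mul, ← integral_add integrable_re (integrable_im.const_mul _)]
  refine integral_congr_ae (Eventually.of_forall fun x => ?_)
  simp only [Complex.real_smul]
  linear_combination -f x * Complex.re_add_im (η x)

lemma HasWeakDeriv.integral_deriv_mul {f g : ℝ → ℂ} (h : HasWeakDeriv f g) (hf : Integrable f)
    (hg : Integrable g) {χ : ℝ → ℂ} (hχ : ContDiff ℝ ∞ χ) (hc : HasCompactSupport χ) :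
    ∫ x, deriv χ x * f x = -∫ x, χ x * g x := by
  have hasDerivAt (x : ℝ) : HasDerivAt χ (deriv χ x) x :=
    (hχ.differentiable (by simp) x).hasDerivAt
  have deriv_re (x : ℝ) : deriv (fun x => (χ x).re) x = (deriv χ x).re :=
    (Complex.reCLM.hasFDerivAt.comp_hasDerivAt x (hasDerivAt x)).deriv
  have deriv_im (x : ℝ) : deriv (fun x => (χ x).im) x = (deriv χ x).im :=
    (Complex.imCLM.hasFDerivAt.comp_hasDerivAt x (hasDerivAt x)).deriv
  have key_re := h _ (Complex.reCLM.contDiff.comp hχ) (hc.comp_left Complex.zero_re)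
  have key_im := h _ (Complex.imCLM.contDiff.comp hχ) (hc.comp_left Complex.zero_im)
  simp only [Function.comp_def, Complex.reCLM_apply, Complex.imCLM_apply, deriv_re, deriv_im]
    at key_re key_im
  rw [integral_mul_eq_re_add_im (hχ.continuous_deriv (by norm_num)) hc.deriv hf,
    integral_mul_eq_re_add_im hχ.continuous hc hg, key_re, key_im]
  ring

/-- A multiplier of `W^{1,1}(ℝ)`: a smooth function that is bounded and has a bounded derivative. -/
structure IsMultiplier (ψ : ℝ → ℂ) : Prop where
  contDiff : ContDiff ℝ ∞ ψ
  bounded : ∃ A, ∀ x, ‖ψ x‖ ≤ A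
  bounded_deriv : ∃ B, ∀ x, ‖deriv ψ x‖ ≤ B

namespace IsMultiplier

variable {ψ : ℝ → ℂ}

lemma continuous_deriv (hψ : IsMultiplier ψ) : Continuous (deriv ψ) :=
  hψ.contDiff.continuous_deriv (by norm_num)

lemma hasDerivAt (hψ : IsMultiplier ψ) (x : ℝ) : HasDerivAt ψ (deriv ψ x) x :=
  (hψ.contDiff.differentiable (by simp) x).hasDerivAt

lemma integrable_mul (hψ : IsMultiplier ψ) {f : ℝ → ℂ} (hf : Integrable f) :
    Integrable fun x => ψ x * f x :=
  let ⟨A, hA⟩ := hψ.bounded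
  hf.bdd_mul (c := A) hψ.contDiff.continuous.aestronglyMeasurable (Eventually.of_forall hA)

lemma integrable_deriv_mul (hψ : IsMultiplier ψ) {f : ℝ → ℂ} (hf : Integrable f) :
    Integrable fun x => deriv ψ x * f x :=
  let ⟨B, hB⟩ := hψ.bounded_deriv
  hf.bdd_mul (c := B) hψ.continuous_deriv.aestronglyMeasurable (Eventually.of_forall hB)

lemma hasWeakDeriv_mul (hψ : IsMultiplier ψ) {f g : ℝ → ℂ} (h : HasWeakDeriv f g)
    (hf : Integrable f) (hg : Integrable g) :
    HasWeakDeriv (fun x => ψ x * f x) (fun x => ψ x * g x + deriv ψ x * f x) := by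
  intro φ hφ hc
  have deriv_smul (x : ℝ) :
      deriv (φ • ψ) x = φ x • deriv ψ x + deriv φ x • ψ x :=
    ((hφ.differentiable (by simp) x).hasDerivAt.smul (hψ.hasDerivAt x)).deriv
  have key := h.integral_deriv_mul hf hg (hφ.smul hψ.contDiff) hc.smul_right
  simp only [deriv_smul, Pi.smul_apply', add_mul, smul_mul_assoc] at key
  rw [integral_add (integrable_smul_of_test hφ.continuous hc (hψ.integrable_deriv_mul hf))
    (integrable_deriv_smul_of_test hφ hc (hψ.integrable_mul hf))] at key
  simp only [smul_add]
  rw [integral_add (integrable_smul_of_test hφ.continuous hc (hψ.integrable_mul hg))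
    (integrable_smul_of_test hφ.continuous hc (hψ.integrable_deriv_mul hf))]
  linear_combination key

lemma memW11_mul (hψ : IsMultiplier ψ) {f : ℝ → ℂ} (hf : MemW11 f) :
    MemW11 fun x => ψ x * f x :=
  let ⟨hf, _, hg, h⟩ := hf
  ⟨hψ.integrable_mul hf, _, (hψ.integrable_mul hg).add (hψ.integrable_deriv_mul hf),
    hψ.hasWeakDeriv_mul h hf hg⟩

end IsMultiplier

namespace W11

lemma integrable_fn' (F : W11) : Integrable F.fn' := L1.integrable_coeFn _

lemma hasWeakDeriv (F : W11) : HasWeakDeriv F.fn F.fn' := F.2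

lemma fn_sub (F G : W11) : (F - G).fn =ᵐ[volume] F.fn - G.fn := Lp.coeFn_sub _ _

lemma norm_eq_of_hasWeakDeriv {F : W11} {f g : ℝ → ℂ} (hf : F.fn =ᵐ[volume] f)
    (h : HasWeakDeriv f g) (hg : Integrable g) : ‖F‖ = (∫ x, ‖f x‖) + ∫ x, ‖g x‖ := by
  have h' : F.fn' =ᵐ[volume] g :=
    (F.hasWeakDeriv.congr hf .rfl).unique h F.integrable_fn'.locallyIntegrable
      hg.locallyIntegrable
  rw [norm_eq]
  exact congrArg₂ (· + ·) (integral_congr_ae (hf.fun_comp norm))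
    (integral_congr_ae (h'.fun_comp norm))

/-- The continuous representative of an element of `W^{1,1}(ℝ)`. -/
def rep (F : W11) : ℝ → ℂ := primitive F.fn'

lemma fn_ae_eq_rep (F : W11) : F.fn =ᵐ[volume] F.rep :=
  F.hasWeakDeriv.ae_eq_primitive F.integrable_fn F.integrable_fn'

lemma continuous_rep (F : W11) : Continuous F.rep := continuous_primitive F.integrable_fn'

lemma rep_eq {F : W11} {f : ℝ → ℂ} (h : F.fn =ᵐ[volume] f) (hf : Continuous f) : F.rep = f :=
  (F.continuous_rep.ae_eq_iff_eq volume hf).1 (F.fn_ae_eq_rep.symm.trans h)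

lemma norm_rep_le (F : W11) (x : ℝ) : ‖F.rep x‖ ≤ ‖F‖ := by
  refine (norm_primitive_le F.integrable_fn' x).trans ?_
  rw [norm_eq]
  exact le_add_of_nonneg_left (integral_nonneg fun _ => norm_nonneg _)

/-- Evaluation at a point, through the continuous representative. -/
def evalCLM (u : ℝ) : W11 →L[ℂ] ℂ :=
  LinearMap.mkContinuous
    { toFun F := F.rep u
      map_add' F G := congrFun (rep_eq ((fn_add F G).trans (F.fn_ae_eq_rep.add G.fn_ae_eq_rep))
        (F.continuous_rep.add G.continuous_rep)) u
      map_smul' c F := congrFun (rep_eq ((fn_smul c F).trans (F.fn_ae_eq_rep.const_smul c))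
        (F.continuous_rep.const_smul c)) u }
    1 fun F => (F.norm_rep_le u).trans_eq (one_mul _).symm

/-- The bounded version of `integralFunctional`. -/
def integralCLM : W11 →L[ℂ] ℂ :=
  integralFunctional.mkContinuous 1 fun F => by
    rw [one_mul, norm_eq]
    exact (norm_integral_le_integral_norm _).trans
      (le_add_of_nonneg_right (integral_nonneg fun _ => norm_nonneg _))

end W11

namespace IsMultiplier

variable {ψ : ℝ → ℂ}

lemma norm_toW11_mul (hψ : IsMultiplier ψ) (F : W11) : ‖(hψ.memW11_mul F.memW11).toW11‖ =
    (∫ x, ‖ψ x * F.fn x‖) + ∫ x, ‖ψ x * F.fn' x + deriv ψ x * F.fn x‖ :=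
  W11.norm_eq_of_hasWeakDeriv (hψ.memW11_mul F.memW11).fn_toW11
    (hψ.hasWeakDeriv_mul F.hasWeakDeriv F.integrable_fn F.integrable_fn')
    ((hψ.integrable_mul F.integrable_fn').add (hψ.integrable_deriv_mul F.integrable_fn))

lemma exists_norm_toW11_mul_le (hψ : IsMultiplier ψ) :
    ∃ C, ∀ F : W11, ‖(hψ.memW11_mul F.memW11).toW11‖ ≤ C * ‖F‖ := by
  obtain ⟨A, hA⟩ := hψ.bounded
  obtain ⟨B, hB⟩ := hψ.bounded_deriv
  have hB₀ : 0 ≤ B := (norm_nonneg _).trans (hB 0)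
  refine ⟨A + B, fun F => ?_⟩
  have h := F.integrable_fn.norm
  have h' := F.integrable_fn'.norm
  rw [hψ.norm_toW11_mul, W11.norm_eq]
  calc (∫ x, ‖ψ x * F.fn x‖) + ∫ x, ‖ψ x * F.fn' x + deriv ψ x * F.fn x‖
    _ ≤ (∫ x, A * ‖F.fn x‖) + ∫ x, (A * ‖F.fn' x‖ + B * ‖F.fn x‖) := by
        refine add_le_add
          (integral_mono (hψ.integrable_mul F.integrable_fn).norm (h.const_mul A) fun x => ?_)
          (integral_mono ((hψ.integrable_mul F.integrable_fn').add
            (hψ.integrable_deriv_mul F.integrable_fn)).norm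
            ((h'.const_mul A).add (h.const_mul B)) fun x => ?_)
        · exact norm_mul_le_of_le (hA x) le_rfl
        · exact norm_add_le_of_le (norm_mul_le_of_le (hA x) le_rfl)
            (norm_mul_le_of_le (hB x) le_rfl)
    _ = (A + B) * (∫ x, ‖F.fn x‖) + A * ∫ x, ‖F.fn' x‖ := by
        rw [integral_add (h'.const_mul A) (h.const_mul B)]
        simp only [integral_const_mul]
        ring
    _ ≤ (A + B) * ((∫ x, ‖F.fn x‖) + ∫ x, ‖F.fn' x‖) := by
        rw [mul_add]
        gcongr
        exact le_add_of_nonneg_right hB₀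

/-- Multiplication by a multiplier, as a bounded operator on `W^{1,1}(ℝ)`. -/
def mulCLM (hψ : IsMultiplier ψ) : W11 →L[ℂ] W11 :=
  LinearMap.mkContinuousOfExistsBound
    { toFun F := (hψ.memW11_mul F.memW11).toW11
      map_add' F G := W11.ext_fn <| by
        filter_upwards [(hψ.memW11_mul F.memW11).fn_toW11, (hψ.memW11_mul G.memW11).fn_toW11,
          (hψ.memW11_mul (F + G).memW11).fn_toW11, W11.fn_add F G,
          W11.fn_add (hψ.memW11_mul F.memW11).toW11 (hψ.memW11_mul G.memW11).toW11]
          with x hF hG hFG h_fn h_mul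
        rw [hFG, h_fn, h_mul, Pi.add_apply, Pi.add_apply, hF, hG, mul_add]
      map_smul' c F := W11.ext_fn <| by
        filter_upwards [(hψ.memW11_mul F.memW11).fn_toW11,
          (hψ.memW11_mul (c • F).memW11).fn_toW11, W11.fn_smul c F,
          W11.fn_smul c (hψ.memW11_mul F.memW11).toW11] with x hF hcF h_fn h_mul
        rw [hcF, h_fn, RingHom.id_apply, h_mul, Pi.smul_apply, Pi.smul_apply, hF, smul_eq_mul,
          smul_eq_mul, mul_left_comm] }
    hψ.exists_norm_toW11_mul_le

lemma mulCLM_fn (hψ : IsMultiplier ψ) (F : W11) :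
    (hψ.mulCLM F).fn =ᵐ[volume] fun x => ψ x * F.fn x :=
  (hψ.memW11_mul F.memW11).fn_toW11

end IsMultiplier

lemma ofReal_sub_ne_zero {u : ℂ} (hu : u.im ≠ 0) (v : ℝ) : (v : ℂ) - u ≠ 0 := fun h =>
  hu (by simpa using congrArg Complex.im h)

lemma hasDerivAt_inv_sub {u : ℂ} {v : ℝ} (hv : (v : ℂ) - u ≠ 0) :
    HasDerivAt (fun v : ℝ => ((v : ℂ) - u)⁻¹) (-(((v : ℂ) - u)⁻¹ ^ 2)) v := by
  refine ((Complex.ofRealCLM.hasDerivAt.sub_const u).fun_inv hv).congr_deriv ?_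
  simp [neg_div]

lemma norm_inv_sub_le {u : ℂ} (hu : u.im ≠ 0) (v : ℝ) : ‖((v : ℂ) - u)⁻¹‖ ≤ |u.im|⁻¹ := by
  rw [norm_inv]
  refine inv_anti₀ (abs_pos.2 hu) ?_
  simpa using Complex.abs_im_le_norm ((v : ℂ) - u)

lemma isMultiplier_inv_sub {u : ℂ} (hu : u.im ≠ 0) :
    IsMultiplier fun v : ℝ => ((v : ℂ) - u)⁻¹ where
  contDiff := (Complex.ofRealCLM.contDiff.sub contDiff_const).inv (ofReal_sub_ne_zero hu)
  bounded := ⟨_, norm_inv_sub_le hu⟩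
  bounded_deriv := ⟨|u.im|⁻¹ ^ 2, fun v => by
    rw [(hasDerivAt_inv_sub (ofReal_sub_ne_zero hu v)).deriv, norm_neg, norm_pow]
    exact pow_le_pow_left₀ (norm_nonneg _) (norm_inv_sub_le hu v) 2⟩

/-! ### Rank one perturbations -/

section RankOnePerturbation

section Algebraic

variable {𝕜 V E : Type*} [Field 𝕜] [AddCommGroup V] [Module 𝕜 V] [AddCommGroup E] [Module 𝕜 E]
  {A : V →ₗ[𝕜] E} {ℓ : V →ₗ[𝕜] 𝕜} {h : E}

lemma injective_sub_smulRight_iff (hA : Function.Injective A) :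
    Function.Injective (A - ℓ.smulRight h) ↔ ¬ ∃ x, A x = h ∧ ℓ x = 1 := by
  rw [injective_iff_map_eq_zero]
  simp only [LinearMap.sub_apply, LinearMap.smulRight_apply]
  refine ⟨fun hS ⟨x, hx, hℓ⟩ => ?_, fun hex x hx => ?_⟩
  · have : x = 0 := hS x (by rw [hx, hℓ, one_smul, sub_self])
    simp [this] at hℓ
  · by_contra hx₀
    have hAx : A x = ℓ x • h := sub_eq_zero.1 hx
    have hℓx : ℓ x ≠ 0 := fun hℓ =>
      hx₀ ((injective_iff_map_eq_zero A).1 hA x (by rw [hAx, hℓ, zero_smul]))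
    exact hex ⟨(ℓ x)⁻¹ • x, by rw [map_smul, hAx, inv_smul_smul₀ hℓx],
      by rw [map_smul, smul_eq_mul, inv_mul_cancel₀ hℓx]⟩

end Algebraic

section Topological

variable {𝕜 V E : Type*} [NontriviallyNormedField 𝕜] [AddCommGroup V] [Module 𝕜 V]
  [NormedAddCommGroup E] [NormedSpace 𝕜 E] {A : V →ₗ[𝕜] E} {ℓ : V →ₗ[𝕜] 𝕜} {h : E}
  {e : E →L[𝕜] 𝕜}

lemma mem_closure_range_sub_smulRight (hℓ : ¬ ∃ C, ∀ x, ‖ℓ x‖ ≤ C * ‖A x‖) :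
    h ∈ (LinearMap.range (A - ℓ.smulRight h)).topologicalClosure := by
  refine Metric.mem_closure_iff.2 fun ε hε => ?_
  push Not at hℓ
  obtain ⟨x, hx⟩ := hℓ ε⁻¹
  have hℓx : 0 < ‖ℓ x‖ := (mul_nonneg (inv_nonneg.2 hε.le) (norm_nonneg _)).trans_lt hx
  refine ⟨_, ⟨-((ℓ x)⁻¹ • x), rfl⟩, ?_⟩
  have sub_eq : h - (A - ℓ.smulRight h) (-((ℓ x)⁻¹ • x)) = (ℓ x)⁻¹ • A x := by
    simp only [map_neg, map_smul, LinearMap.sub_apply, LinearMap.smulRight_apply, smul_sub,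
      inv_smul_smul₀ (norm_pos_iff.1 hℓx)]
    abel
  rw [dist_eq_norm, sub_eq, norm_smul, norm_inv, inv_mul_lt_iff₀ hℓx, mul_comm]
  exact (inv_mul_lt_iff₀ hε).1 hx

lemma dense_range_sub_smulRight (hℓ : ¬ ∃ C, ∀ x, ‖ℓ x‖ ≤ C * ‖A x‖)
    (he : ∀ y, e y = 0 → y ∈ (LinearMap.range A).topologicalClosure) (heh : e h ≠ 0) :
    Dense (range (A - ℓ.smulRight h)) := by
  set S := A - ℓ.smulRight h
  have mem_h : h ∈ (LinearMap.range S).topologicalClosure := mem_closure_range_sub_smulRight hℓ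
  have range_le : LinearMap.range A ≤ (LinearMap.range S).topologicalClosure := by
    rintro _ ⟨x, rfl⟩
    have : A x = S x + ℓ x • h := by simp [S]
    rw [this]
    exact add_mem (Submodule.le_topologicalClosure _ ⟨x, rfl⟩) (Submodule.smul_mem _ _ mem_h)
  have closure_le := Submodule.topologicalClosure_minimal _ range_le
    (Submodule.isClosed_topologicalClosure _)
  intro y
  change y ∈ (LinearMap.range S).topologicalClosure
  rw [← sub_add_cancel y ((e y / e h) • h)]
  refine add_mem (closure_le (he _ ?_)) (Submodule.smul_mem _ _ mem_h)
  rw [map_sub, map_smul, smul_eq_mul, div_mul_cancel₀ _ heh, sub_self]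

lemma not_dense_range_sub_smulRight (heA : ∀ x, e (A x) = 0) (heh : e h = 0) (he : e ≠ 0) :
    ¬ Dense (range (A - ℓ.smulRight h)) := fun hd =>
  he <| DFunLike.coe_injective <| e.continuous.ext_on hd continuous_const <| by
    rintro _ ⟨x, rfl⟩
    simp [heA, heh]

end Topological

section BoundedBelow

variable {𝕜 V E : Type*} [NontriviallyNormedField 𝕜] [SeminormedAddCommGroup V] [Module 𝕜 V]
  [NormedAddCommGroup E] [NormedSpace 𝕜 E] {A : V →ₗ[𝕜] E} {ℓ : V →ₗ[𝕜] 𝕜} {h : E}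

/- A lower bound for the perturbed operator would turn the interpolation inequality for `ℓ`, with
`δ` small, into a bound of `ℓ` relative to `A`. -/
lemma not_boundedBelow_sub_smulRight (hℓ : ¬ ∃ C, ∀ x, ‖ℓ x‖ ≤ C * ‖A x‖)
    (interp : ∀ δ > (0 : ℝ), ∃ C, ∀ x, ‖ℓ x‖ ≤ δ * ‖x‖ + C * ‖A x‖) :
    ¬ ∃ C, ∀ x, ‖x‖ ≤ C * ‖(A - ℓ.smulRight h) x‖ := by
  rintro ⟨C, hC⟩
  obtain ⟨D, hD⟩ := interp (2 * (|C| * ‖h‖ + 1))⁻¹ (by positivity)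
  set δ := (2 * (|C| * ‖h‖ + 1))⁻¹ with hδ
  have : 0 < δ := by positivity
  refine hℓ ⟨2 * (δ * |C| + D), fun x => ?_⟩
  have norm_le : ‖x‖ ≤ |C| * (‖A x‖ + ‖ℓ x‖ * ‖h‖) := by
    refine (hC x).trans (mul_le_mul (le_abs_self C) ?_ (norm_nonneg _) (abs_nonneg C))
    rw [← norm_smul]
    exact norm_sub_le _ _
  have absorb : δ * (|C| * ‖h‖) ≤ 1 / 2 := by
    rw [hδ, inv_mul_le_iff₀ (by positivity)]
    linarith
  have := calc ‖ℓ x‖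
    _ ≤ δ * (|C| * (‖A x‖ + ‖ℓ x‖ * ‖h‖)) + D * ‖A x‖ := (hD x).trans (by gcongr)
    _ = δ * (|C| * ‖h‖) * ‖ℓ x‖ + (δ * |C| + D) * ‖A x‖ := by ring
    _ ≤ 1 / 2 * ‖ℓ x‖ + (δ * |C| + D) * ‖A x‖ := by gcongr
  linarith

end BoundedBelow

section Resolvent

variable {𝕜 E : Type*} [NontriviallyNormedField 𝕜] [NormedAddCommGroup E] [NormedSpace 𝕜 E]

/-- `R` is an everywhere defined bounded inverse of the operator `S`, which has domain `D`. -/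
structure IsBoundedInverse {D : Submodule 𝕜 E} (S : D →ₗ[𝕜] E) (R : E →L[𝕜] E) : Prop where
  left_inv : ∀ x : D, R (S x) = x
  right_inv : ∀ y, ∃ x : D, (x : E) = R y ∧ S x = y

namespace IsBoundedInverse

variable {D : Submodule 𝕜 E} {S : D →ₗ[𝕜] E} {R : E →L[𝕜] E}

lemma injective (hR : IsBoundedInverse S R) : Function.Injective S := fun x y hxy =>
  Subtype.ext (by rw [← hR.left_inv x, ← hR.left_inv y, hxy])

lemma surjective (hR : IsBoundedInverse S R) : Function.Surjective S := fun y =>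
  let ⟨x, _, hx⟩ := hR.right_inv y
  ⟨x, hx⟩

lemma norm_le (hR : IsBoundedInverse S R) (x : D) : ‖(x : E)‖ ≤ ‖R‖ * ‖S x‖ := by
  rw [← hR.left_inv x]
  exact R.le_opNorm _

/- The Sherman–Morrison formula. -/
lemma sub_smulRight {ℓ : E →L[𝕜] 𝕜} {h : E} (hR : IsBoundedInverse S R) (hd : ℓ (R h) ≠ 1) :
    IsBoundedInverse (S - (ℓ.toLinearMap ∘ₗ D.subtype).smulRight h)
      (R + ((1 - ℓ (R h))⁻¹ • ℓ ∘L R).smulRight (R h)) := by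
  have hd' : 1 - ℓ (R h) ≠ 0 := sub_ne_zero.2 hd.symm
  have perturbed_apply (x : D) :
      (S - (ℓ.toLinearMap ∘ₗ D.subtype).smulRight h) x = S x - ℓ x • h := rfl
  have inverse_apply (y : E) : (R + ((1 - ℓ (R h))⁻¹ • ℓ ∘L R).smulRight (R h)) y =
      R y + ((1 - ℓ (R h))⁻¹ * ℓ (R y)) • R h := rfl
  constructor
  · intro x
    rw [perturbed_apply, inverse_apply, map_sub, map_smul, hR.left_inv, map_sub, map_smul,
      smul_eq_mul, ← mul_one_sub, mul_comm (ℓ x), inv_mul_cancel_left₀ hd', sub_add_cancel]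
  · intro y
    obtain ⟨a, ha, hSa⟩ := hR.right_inv y
    obtain ⟨b, hb, hSb⟩ := hR.right_inv h
    set c := (1 - ℓ (R h))⁻¹ * ℓ (R y) with hc
    have ℓ_eq : ℓ (R y + c • R h) = c := by
      rw [map_add, map_smul, smul_eq_mul, hc]
      field_simp
      ring
    have coe_eq : ((a + c • b : D) : E) = R y + c • R h := by simp [ha, hb]
    refine ⟨a + c • b, coe_eq, ?_⟩
    rw [perturbed_apply, coe_eq, ℓ_eq, map_add, map_smul, hSa, hSb, add_sub_cancel_right]

lemma exists_sub_smulRight {ℓ : E →L[𝕜] 𝕜} {h : E} (hR : IsBoundedInverse S R)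
    (hinj : Function.Injective (S - (ℓ.toLinearMap ∘ₗ D.subtype).smulRight h)) :
    ∃ R', IsBoundedInverse (S - (ℓ.toLinearMap ∘ₗ D.subtype).smulRight h) R' := by
  refine ⟨_, hR.sub_smulRight fun hd => (injective_sub_smulRight_iff hR.injective).1 hinj ?_⟩
  obtain ⟨x, hx, hSx⟩ := hR.right_inv h
  exact ⟨x, hSx, by simpa [hx] using hd⟩

end IsBoundedInverse

end Resolvent

end RankOnePerturbation

section Spectrum

variable {E : Type*} [NormedAddCommGroup E] [NormedSpace ℂ E] {T : E →ₗ.[ℂ] E} {z : ℂ}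

lemma notMem_spectrum_iff : z ∉ spectrum T ↔ ∃ R, IsBoundedInverse (shifted T z) R :=
  not_not.trans (exists_congr fun _ => ⟨fun h => ⟨h.1, h.2⟩, fun h => ⟨h.1, h.2⟩⟩)

lemma union_subset_spectrum (T : E →ₗ.[ℂ] E) :
    pointSpectrum T ∪ continuousSpectrum T ∪ residualSpectrum T ⊆ spectrum T := by
  refine fun z hz => by_contra fun hz' => ?_
  obtain ⟨R, hR⟩ := notMem_spectrum_iff.1 hz'
  rcases hz with (h | h) | h
  · exact h hR.injective
  · exact h.2.2 ⟨_, hR.norm_le⟩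
  · exact h.2 hR.surjective.denseRange

end Spectrum

/-! ### The free transport operator -/

/-- The operator `f ↦ i (v - u) f`, which is `T - i u I` without its integral term. -/
def freeTransport (u : ℂ) : velocityMul.domain →ₗ[ℂ] W11 := Complex.I • shifted velocityMul u

lemma shifted_vlasovOperator (k : ℝ) (g : W11) (u : ℂ) :
    shifted (vlasovOperator k g) (Complex.I * u) =
      freeTransport u - (W11.integralCLM.toLinearMap ∘ₗ velocityMul.domain.subtype).smulRight
        ((Complex.I * ((k : ℂ) ^ 2)⁻¹) • g) := by
  ext1 x
  change Complex.I • velocityMul x - (∫ v, x.1.fn v) • _ - (Complex.I * u) • (x : W11) =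
    Complex.I • (velocityMul x - u • (x : W11)) - (∫ v, x.1.fn v) • _
  rw [smul_sub, mul_smul Complex.I u, sub_right_comm]

namespace freeTransport

variable {u : ℂ}

lemma fn_apply (x : velocityMul.domain) : (freeTransport u x).fn =ᵐ[volume]
    fun v : ℝ => Complex.I * (((v : ℂ) - u) * x.1.fn v) := by
  filter_upwards [W11.fn_smul Complex.I (velocityMul x - u • x.1),
    W11.fn_sub (velocityMul x) (u • x.1), W11.fn_smul u x.1, MemW11.fn_toW11 x.2]
    with v h_smul h_sub h_u h_v
  refine h_smul.trans ?_
  rw [Pi.smul_apply, h_sub, Pi.sub_apply, h_u, Pi.smul_apply, smul_eq_mul, smul_eq_mul, sub_mul]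
  exact congrArg (fun w => Complex.I * (w - u * x.1.fn v)) h_v

lemma exists_apply_eq {F P : W11} (h : P.fn =ᵐ[volume] fun v : ℝ => ((v : ℂ) - u) * F.fn v) :
    ∃ x : velocityMul.domain, x.1 = F ∧ freeTransport u x = Complex.I • P := by
  have memW11 : MemW11 fun v : ℝ => (v : ℂ) * F.fn v := by
    refine (P.memW11.add (F.memW11.const_smul u)).congr ?_
    filter_upwards [h] with v hv
    rw [Pi.add_apply, Pi.smul_apply, hv, smul_eq_mul, sub_mul, sub_add_cancel]
  refine ⟨⟨F, memW11⟩, rfl, W11.ext_fn ?_⟩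
  filter_upwards [fn_apply (u := u) ⟨F, memW11⟩, W11.fn_smul Complex.I P, h] with v h_fn h_smul hv
  rw [h_fn, h_smul, Pi.smul_apply, hv, smul_eq_mul]

lemma injective : Function.Injective (freeTransport u) := by
  refine (injective_iff_map_eq_zero _).2 fun x hx => Subtype.ext (W11.ext_fn ?_)
  have fn_zero := W11.fn_zero
  rw [← hx] at fn_zero
  filter_upwards [fn_apply (u := u) x, fn_zero, W11.fn_zero, Measure.ae_ne volume u.re]
    with v h_fn h_zero h_zero' hv
  have sub_ne_zero : (v : ℂ) - u ≠ 0 := fun h =>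
    hv (by simpa [sub_eq_zero] using congrArg Complex.re h)
  rw [Submodule.coe_zero, h_zero']
  simpa [h_zero, sub_ne_zero] using h_fn

lemma isBoundedInverse (hu : u.im ≠ 0) :
    IsBoundedInverse (freeTransport u) (-Complex.I • (isMultiplier_inv_sub hu).mulCLM) := by
  set M := (isMultiplier_inv_sub hu).mulCLM
  have hM (F : W11) : (M F).fn =ᵐ[volume] fun v : ℝ => ((v : ℂ) - u)⁻¹ * F.fn v :=
    (isMultiplier_inv_sub hu).mulCLM_fn F
  constructor
  · refine fun x => W11.ext_fn ?_
    filter_upwards [W11.fn_smul (-Complex.I) (M (freeTransport u x)), hM (freeTransport u x),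
      fn_apply (u := u) x] with v h_smul h_M h_fn
    refine h_smul.trans ?_
    rw [Pi.smul_apply, h_M, h_fn, smul_eq_mul, ← mul_assoc, ← mul_assoc, ← mul_assoc,
      mul_right_comm (-Complex.I), neg_mul, Complex.I_mul_I, neg_neg, one_mul,
      inv_mul_cancel₀ (ofReal_sub_ne_zero hu v), one_mul]
  · intro y
    obtain ⟨x, hx, h⟩ := exists_apply_eq (u := u) (F := M y) (P := y) <| by
      filter_upwards [hM y] with v hv
      rw [hv, mul_inv_cancel_left₀ (ofReal_sub_ne_zero hu v)]
    exact ⟨-Complex.I • x, congrArg (-Complex.I • ·) hx, by simp [h, smul_smul]⟩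

lemma evalCLM_apply (u : ℝ) (x : velocityMul.domain) : W11.evalCLM u (freeTransport u x) = 0 := by
  have : (freeTransport u x).rep = fun v : ℝ => Complex.I * (((v : ℂ) - u) * x.1.rep v) := by
    refine W11.rep_eq ((fn_apply x).trans ?_) ?_
    · filter_upwards [x.1.fn_ae_eq_rep] with v hv
      rw [hv]
    · have := x.1.continuous_rep
      fun_prop
  change (freeTransport u x).rep u = 0
  simp only [this, sub_self, zero_mul, mul_zero]

end freeTransport

lemma norm_integralCLM_le (u : ℝ) {δ : ℝ} (hδ : 0 < δ) (x : velocityMul.domain) :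
    ‖W11.integralCLM x.1‖ ≤ 2 * δ * ‖x.1‖ + δ⁻¹ * ‖freeTransport u x‖ := by
  set y := freeTransport u x with hy
  have volume_ne_top : volume (Icc (u - δ) (u + δ)) ≠ ⊤ := measure_Icc_lt_top.ne
  have integrable_near : Integrable ((Icc (u - δ) (u + δ)).indicator fun _ => ‖x.1‖) :=
    (integrable_indicator_iff measurableSet_Icc).2 (integrableOn_const volume_ne_top)
  have norm_fn_le : ∀ᵐ v : ℝ, ‖x.1.fn v‖ ≤
      (Icc (u - δ) (u + δ)).indicator (fun _ => ‖x.1‖) v + δ⁻¹ * ‖y.fn v‖ := by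
    filter_upwards [x.1.fn_ae_eq_rep, freeTransport.fn_apply (u := u) x] with v h_rep h_fn
    by_cases hv : v ∈ Icc (u - δ) (u + δ)
    · rw [indicator_of_mem hv, h_rep]
      exact (x.1.norm_rep_le v).trans (le_add_of_nonneg_right (by positivity))
    · rw [indicator_of_notMem hv, zero_add, hy, h_fn, norm_mul, Complex.norm_I, one_mul, norm_mul,
        ← Complex.ofReal_sub, Complex.norm_real, Real.norm_eq_abs, le_inv_mul_iff₀ hδ]
      gcongr
      by_contra! hlt
      exact hv ⟨by linarith [(abs_lt.1 hlt).1], by linarith [(abs_lt.1 hlt).2]⟩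
  calc ‖W11.integralCLM x.1‖
    _ ≤ ∫ v, ‖x.1.fn v‖ := norm_integral_le_integral_norm _
    _ ≤ ∫ v, ((Icc (u - δ) (u + δ)).indicator (fun _ => ‖x.1‖) v + δ⁻¹ * ‖y.fn v‖) :=
        integral_mono_ae x.1.integrable_fn.norm
          (integrable_near.add (y.integrable_fn.norm.const_mul _)) norm_fn_le
    _ = 2 * δ * ‖x.1‖ + δ⁻¹ * ∫ v, ‖y.fn v‖ := by
        rw [integral_add integrable_near (y.integrable_fn.norm.const_mul _), integral_const_mul,
          integral_indicator_const _ measurableSet_Icc, Real.volume_real_Icc_of_le (by linarith),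
          smul_eq_mul]
        ring
    _ ≤ 2 * δ * ‖x.1‖ + δ⁻¹ * ‖y‖ := by
        gcongr
        rw [y.norm_eq]
        exact le_add_of_nonneg_right (integral_nonneg fun _ => norm_nonneg _)

lemma norm_mulCLM_inv_sub_le {u : ℂ} (hu : u.im ≠ 0) (F : W11) :
    ‖(isMultiplier_inv_sub hu).mulCLM F‖ ≤
      (∫ v : ℝ, ‖((v : ℂ) - u)⁻¹‖ * (‖F.fn v‖ + ‖F.fn' v‖)) +
        ∫ v : ℝ, ‖((v : ℂ) - u)⁻¹‖ ^ 2 * ‖F.rep v‖ := by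
  have hM := isMultiplier_inv_sub hu
  have int_fn := (hM.integrable_mul F.integrable_fn).norm
  have int_fn' := (hM.integrable_mul F.integrable_fn').norm
  have int_deriv := (hM.integrable_deriv_mul F.integrable_fn).norm
  have integral_deriv : ∫ v, ‖deriv (fun v : ℝ => ((v : ℂ) - u)⁻¹) v * F.fn v‖ =
      ∫ v : ℝ, ‖((v : ℂ) - u)⁻¹‖ ^ 2 * ‖F.rep v‖ := by
    refine integral_congr_ae ?_
    filter_upwards [F.fn_ae_eq_rep] with v hv
    rw [(hasDerivAt_inv_sub (ofReal_sub_ne_zero hu v)).deriv, hv, norm_mul, norm_neg, norm_pow]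
  calc ‖hM.mulCLM F‖
    _ ≤ (∫ v : ℝ, ‖((v : ℂ) - u)⁻¹ * F.fn v‖) + ∫ v : ℝ, (‖((v : ℂ) - u)⁻¹ * F.fn' v‖ +
          ‖deriv (fun v : ℝ => ((v : ℂ) - u)⁻¹) v * F.fn v‖) := by
        refine (hM.norm_toW11_mul F).trans_le (add_le_add_right ?_ _)
        exact integral_mono ((hM.integrable_mul F.integrable_fn').add
          (hM.integrable_deriv_mul F.integrable_fn)).norm (int_fn'.add int_deriv)
          fun v => norm_add_le _ _
    _ = _ := by
        rw [integral_add int_fn' int_deriv, ← add_assoc, ← integral_add int_fn int_fn',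
          integral_deriv]
        simp only [norm_mul, mul_add]

lemma norm_inv_sub_add_mul_I_sq (u ε v : ℝ) :
    ‖((v : ℂ) - (u + ε * Complex.I))⁻¹‖ ^ 2 = ((v - u) ^ 2 + ε ^ 2)⁻¹ := by
  rw [norm_inv, inv_pow, Complex.sq_norm, Complex.normSq_apply]
  simp [pow_two]

lemma tendsto_integral_mul_norm_inv_sub {f : ℝ → ℝ} (hf : Integrable f) (u : ℝ) :
    Tendsto (fun ε : ℝ => ∫ v : ℝ, ε * ‖((v : ℂ) - (u + ε * Complex.I))⁻¹‖ * f v)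
      (𝓝[>] 0) (𝓝 0) := by
  suffices Tendsto (fun ε : ℝ => ∫ v : ℝ, ε * ‖((v : ℂ) - (u + ε * Complex.I))⁻¹‖ * f v)
      (𝓝[>] 0) (𝓝 (∫ _ : ℝ, (0 : ℝ))) by rwa [integral_zero] at this
  refine tendsto_integral_filter_of_dominated_convergence (fun v => ‖f v‖) ?_ ?_ hf.norm ?_
  · refine Eventually.of_forall fun ε => AEStronglyMeasurable.mul ?_ hf.aestronglyMeasurable
    exact Measurable.aestronglyMeasurable (by fun_prop)
  · filter_upwards [self_mem_nhdsWithin] with ε hε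
    refine Eventually.of_forall fun v => ?_
    have hε : (0 : ℝ) < ε := hε
    rw [norm_mul]
    refine mul_le_of_le_one_left (norm_nonneg _) ?_
    rw [Real.norm_of_nonneg (by positivity), mul_comm, ← le_div_iff₀ hε]
    simpa [abs_of_pos hε] using norm_inv_sub_le (u := u + ε * Complex.I) (by simpa using hε.ne') v
  · filter_upwards [Measure.ae_ne volume u] with v hv
    have sub_ne_zero : (v : ℂ) - (u + (0 : ℝ) * Complex.I) ≠ 0 := by
      simpa [sub_eq_zero] using hv
    have : ContinuousAt (fun ε : ℝ => ε * ‖((v : ℂ) - (u + ε * Complex.I))⁻¹‖ * f v) 0 := by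
      fun_prop (disch := assumption)
    simpa using this.tendsto.mono_left nhdsWithin_le_nhds

/- The Poisson kernel is an approximate identity. -/
lemma tendsto_integral_mul_norm_inv_sub_sq {f : ℝ → ℝ} (hf : Integrable f) {u : ℝ}
    (hu : ContinuousAt f u) :
    Tendsto (fun ε : ℝ => ∫ v : ℝ, ε * ‖((v : ℂ) - (u + ε * Complex.I))⁻¹‖ ^ 2 * f v)
      (𝓝[>] 0) (𝓝 (Real.pi * f u)) := by
  have tail : Tendsto (fun x : ℝ => ‖x‖ ^ Module.finrank ℝ ℝ * (Real.pi⁻¹ * (1 + x ^ 2)⁻¹))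
      (Bornology.cobounded ℝ) (𝓝 0) := by
    refine squeeze_zero (fun x => by positivity) (fun x => ?_)
      (by simpa using
        (tendsto_norm_cobounded_atTop (E := ℝ)).inv_tendsto_atTop.const_mul Real.pi⁻¹)
    rcases eq_or_ne x 0 with rfl | hx
    · simp
    · rw [Module.finrank_self, pow_one, mul_left_comm, Real.norm_eq_abs]
      gcongr
      rw [mul_inv_le_iff₀ (by positivity), inv_mul_eq_div, le_div_iff₀ (abs_pos.2 hx),
        ← pow_two, sq_abs]
      linarith
  have key := ((tendsto_integral_comp_smul_smul_of_integrable' (fun x => by positivity)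
    (by rw [integral_const_mul, integral_univ_inv_one_add_sq, inv_mul_cancel₀ Real.pi_ne_zero])
    tail hf hu).comp tendsto_inv_nhdsGT_zero).const_mul Real.pi
  refine key.congr' ?_
  filter_upwards [self_mem_nhdsWithin] with ε hε
  have hε : (0 : ℝ) < ε := hε
  rw [Function.comp_apply, ← integral_const_mul]
  refine integral_congr_ae (Eventually.of_forall fun v => ?_)
  simp only [norm_inv_sub_add_mul_I_sq, Module.finrank_self, smul_eq_mul]
  have : (v - u) ^ 2 + ε ^ 2 ≠ 0 := by positivity
  field_simp
  ring

namespace freeTransport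

lemma mem_closure_range {u : ℝ} {y : W11} (hy : W11.evalCLM u y = 0) :
    y ∈ (LinearMap.range (freeTransport u)).topologicalClosure := by
  refine Metric.mem_closure_iff.2 fun η hη => ?_
  have integrable_rep : Integrable fun v => ‖y.rep v‖ :=
    (y.integrable_fn.congr y.fn_ae_eq_rep).norm
  have tendsto_bound := (tendsto_integral_mul_norm_inv_sub
    (y.integrable_fn.norm.add y.integrable_fn'.norm) u).add
    (tendsto_integral_mul_norm_inv_sub_sq integrable_rep y.continuous_rep.norm.continuousAt
      (u := u))
  have rep_eq_zero : y.rep u = 0 := hy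
  rw [rep_eq_zero, norm_zero, mul_zero, add_zero] at tendsto_bound
  obtain ⟨ε, hlt, hε⟩ :=
    ((tendsto_bound.eventually_lt_const hη).and self_mem_nhdsWithin).exists
  have hε : (0 : ℝ) < ε := hε
  have im_ne_zero : ((u : ℂ) + ε * Complex.I).im ≠ 0 := by simpa using hε.ne'
  set F := (isMultiplier_inv_sub im_ne_zero).mulCLM y with hF
  obtain ⟨x, -, hx⟩ := exists_apply_eq (u := u) (F := F) (P := y + (ε * Complex.I) • F) <| by
    filter_upwards [W11.fn_add y ((ε * Complex.I) • F), W11.fn_smul (ε * Complex.I) F,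
      (isMultiplier_inv_sub im_ne_zero).mulCLM_fn y] with v h_add h_smul h_F
    have := ofReal_sub_ne_zero im_ne_zero v
    rw [h_add, Pi.add_apply, h_smul, Pi.smul_apply, hF, h_F, smul_eq_mul]
    field_simp
    ring
  refine ⟨_, ⟨-Complex.I • x, rfl⟩, ?_⟩
  rw [map_smul, hx, smul_smul, neg_mul, Complex.I_mul_I, neg_neg, one_smul, dist_self_add_right,
    norm_smul, norm_mul, Complex.norm_I, mul_one, Complex.norm_real, Real.norm_of_nonneg hε.le]
  refine (mul_le_mul_of_nonneg_left (norm_mulCLM_inv_sub_le im_ne_zero y) hε.le).trans_lt ?_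
  rw [mul_add, ← integral_const_mul, ← integral_const_mul]
  simpa only [mul_assoc, Pi.add_apply] using hlt

end freeTransport

lemma IsMultiplier.norm_mulCLM_le {ψ : ℝ → ℂ} (hψ : IsMultiplier ψ) {A : ℝ}
    (hA : ∀ x, ‖ψ x‖ ≤ A) (hd : Integrable (deriv ψ)) (F : W11) :
    ‖hψ.mulCLM F‖ ≤ (A + ∫ x, ‖deriv ψ x‖) * ‖F‖ := by
  have integral_deriv_mul_le : ∫ x, ‖deriv ψ x * F.fn x‖ ≤ (∫ x, ‖deriv ψ x‖) * ‖F‖ := by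
    rw [← integral_mul_const]
    refine integral_mono_ae (hψ.integrable_deriv_mul F.integrable_fn).norm
      (hd.norm.mul_const _) ?_
    filter_upwards [F.fn_ae_eq_rep] with x hx
    rw [hx, norm_mul]
    exact mul_le_mul_of_nonneg_left (F.norm_rep_le x) (norm_nonneg _)
  have integral_mul_le {f : ℝ → ℂ} (hf : Integrable f) :
      ∫ x, ‖ψ x * f x‖ ≤ A * ∫ x, ‖f x‖ := by
    rw [← integral_const_mul]
    exact integral_mono (hψ.integrable_mul hf).norm (hf.norm.const_mul A)
      fun x => norm_mul_le_of_le (hA x) le_rfl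
  have int_fn' := (hψ.integrable_mul F.integrable_fn').norm
  have int_deriv := (hψ.integrable_deriv_mul F.integrable_fn).norm
  calc ‖hψ.mulCLM F‖
    _ ≤ (∫ x, ‖ψ x * F.fn x‖) + ∫ x, (‖ψ x * F.fn' x‖ + ‖deriv ψ x * F.fn x‖) := by
        refine (hψ.norm_toW11_mul F).trans_le (add_le_add_right ?_ _)
        exact integral_mono ((hψ.integrable_mul F.integrable_fn').add
          (hψ.integrable_deriv_mul F.integrable_fn)).norm (int_fn'.add int_deriv)
          fun v => norm_add_le _ _
    _ ≤ A * (∫ x, ‖F.fn x‖) + (A * (∫ x, ‖F.fn' x‖) + (∫ x, ‖deriv ψ x‖) * ‖F‖) := by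
        rw [integral_add int_fn' int_deriv]
        exact add_le_add (integral_mul_le F.integrable_fn)
          (add_le_add (integral_mul_le F.integrable_fn') integral_deriv_mul_le)
    _ = (A + ∫ x, ‖deriv ψ x‖) * ‖F‖ := by
        rw [add_mul, W11.norm_eq, mul_add A, add_assoc]

section Arctan

variable {φ : ℝ → ℝ} (hφ : ContDiff ℝ ∞ φ) {A B : ℝ} (hA : ∀ x, |φ x| ≤ A)
  (hB : ∀ x, |deriv φ x| ≤ B) {s : ℝ} (u : ℝ)

include hφ

lemma hasDerivAt_comp_arctan (s v : ℝ) :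
    HasDerivAt (fun v => ((φ (Real.arctan (s * (v - u))) : ℝ) : ℂ))
      ((deriv φ (Real.arctan (s * (v - u))) * (s * (1 + (s * (v - u)) ^ 2)⁻¹) : ℝ) : ℂ) v := by
  have inner := ((hasDerivAt_id v).sub_const u).const_mul s
  refine (((hφ.differentiable (by simp) _).hasDerivAt.comp v inner.arctan).ofReal_comp
    ).congr_deriv ?_
  simp [mul_comm]

include hA hB

lemma isMultiplier_comp_arctan (s : ℝ) :
    IsMultiplier fun v => ((φ (Real.arctan (s * (v - u))) : ℝ) : ℂ) where
  contDiff := Complex.ofRealCLM.contDiff.comp <| hφ.comp <| Real.contDiff_arctan.comp <|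
    contDiff_const.mul (contDiff_id.sub contDiff_const)
  bounded := ⟨A, fun v => by simpa using hA _⟩
  bounded_deriv := ⟨B * |s|, fun v => by
    rw [(hasDerivAt_comp_arctan hφ u s v).deriv, Complex.norm_real, norm_mul, norm_mul, norm_inv,
      Real.norm_of_nonneg (by positivity : 0 ≤ 1 + (s * (v - u)) ^ 2)]
    refine mul_le_mul (hB _) ?_ (by positivity) ((abs_nonneg _).trans (hB 0))
    exact mul_le_of_le_one_right (abs_nonneg s)
      (inv_le_one_of_one_le₀ (le_add_of_nonneg_right (sq_nonneg _)))⟩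

lemma norm_mulCLM_comp_arctan_le (hs : 0 < s) (F : W11) :
    ‖(isMultiplier_comp_arctan hφ hA hB u s).mulCLM F‖ ≤ (A + B * Real.pi) * ‖F‖ := by
  set ψ := fun v => ((φ (Real.arctan (s * (v - u))) : ℝ) : ℂ)
  have hψ : IsMultiplier ψ := isMultiplier_comp_arctan hφ hA hB u s
  have integrable_cauchy : Integrable fun v => s * (1 + (s * (v - u)) ^ 2)⁻¹ :=
    ((integrable_inv_one_add_sq.comp_mul_left' hs.ne').comp_sub_right u).const_mul s
  have integral_cauchy : ∫ v, s * (1 + (s * (v - u)) ^ 2)⁻¹ = Real.pi := by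
    rw [integral_const_mul, integral_sub_right_eq_self (fun v => (1 + (s * v) ^ 2)⁻¹) u,
      Measure.integral_comp_mul_left (fun x => (1 + x ^ 2)⁻¹) s, integral_univ_inv_one_add_sq,
      abs_of_pos (inv_pos.2 hs), smul_eq_mul, mul_inv_cancel_left₀ hs.ne']
  have norm_deriv_le (v : ℝ) : ‖deriv ψ v‖ ≤ B * (s * (1 + (s * (v - u)) ^ 2)⁻¹) := by
    rw [(hasDerivAt_comp_arctan hφ u s v).deriv, Complex.norm_real, norm_mul,
      Real.norm_of_nonneg (by positivity : 0 ≤ s * (1 + (s * (v - u)) ^ 2)⁻¹)]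
    exact mul_le_mul_of_nonneg_right (hB _) (by positivity)
  have integrable_deriv : Integrable (deriv ψ) :=
    (integrable_cauchy.const_mul B).mono' hψ.continuous_deriv.aestronglyMeasurable
      (Eventually.of_forall norm_deriv_le)
  refine (hψ.norm_mulCLM_le (fun v => by simpa [ψ] using hA _) integrable_deriv F).trans ?_
  gcongr
  rw [← integral_cauchy, ← integral_const_mul]
  exact integral_mono integrable_deriv.norm (integrable_cauchy.const_mul B) norm_deriv_le

end Arctan

lemma memW11_of_hasCompactSupport {f : ℝ → ℂ} (hf : ContDiff ℝ 1 f) (hc : HasCompactSupport f) :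
    MemW11 f :=
  have integrable_deriv := (hf.continuous_deriv le_rfl).integrable_of_hasCompactSupport hc.deriv
  ⟨hf.continuous.integrable_of_hasCompactSupport hc, deriv f, integrable_deriv,
    .of_hasDerivAt_off_countable countable_empty hf.continuous
      (fun x _ => (hf.differentiable one_ne_zero x).hasDerivAt) integrable_deriv⟩

lemma integral_cos_arctan (u s : ℝ) :
    ∫ v in u..u + 1, s * Real.cos (Real.arctan (s * (v - u))) = Real.arsinh s := by
  have hasDerivAt (v : ℝ) : HasDerivAt (fun v => Real.arsinh (s * (v - u)))
      (s * Real.cos (Real.arctan (s * (v - u)))) v := by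
    refine (((hasDerivAt_id v).sub_const u).const_mul s).arsinh.congr_deriv ?_
    rw [Real.cos_arctan]
    simp [mul_comm]
  rw [intervalIntegral.integral_eq_sub_of_hasDerivAt (fun v _ => hasDerivAt v)
    (Continuous.intervalIntegrable (by fun_prop) _ _)]
  simp

lemma arsinh_le_integral {χ : ℝ → ℝ} (hχ : Integrable χ) (hχ₀ : 0 ≤ χ) {u : ℝ}
    (hχ₁ : ∀ v ∈ Ioc u (u + 1), χ v = 1) {s : ℝ} (hs : 0 < s) :
    Real.arsinh s ≤ ∫ v, s * Real.cos (Real.arctan (s * (v - u))) * χ v := by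
  have nonneg (v : ℝ) : 0 ≤ s * Real.cos (Real.arctan (s * (v - u))) :=
    mul_nonneg hs.le (Real.cos_arctan_pos _).le
  have integrable : Integrable fun v => s * Real.cos (Real.arctan (s * (v - u))) * χ v := by
    refine hχ.bdd_mul (c := s) (Continuous.aestronglyMeasurable (by fun_prop))
      (Eventually.of_forall fun v => ?_)
    rw [Real.norm_of_nonneg (nonneg v)]
    exact mul_le_of_le_one_right hs.le (Real.cos_le_one _)
  calc Real.arsinh s
    _ = ∫ v in Ioc u (u + 1), s * Real.cos (Real.arctan (s * (v - u))) * χ v := by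
        rw [← integral_cos_arctan u s, intervalIntegral.integral_of_le (by linarith)]
        refine setIntegral_congr_fun measurableSet_Ioc fun v hv => ?_
        simp only [hχ₁ v hv, mul_one]
    _ ≤ ∫ v, s * Real.cos (Real.arctan (s * (v - u))) * χ v :=
        setIntegral_le_integral integrable
          (Eventually.of_forall fun v => mul_nonneg (nonneg v) (hχ₀ v))

/- Here `(v - u) s cos (arctan (s (v - u))) = sin (arctan (s (v - u)))` is a multiplier whose norm
does not depend on `s`. -/
lemma freeTransport.exists_fn_eq_cos_arctan_mul (u : ℝ) {s : ℝ} (hs : 0 < s) (F : W11) :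
    ∃ x : velocityMul.domain,
      (x.1.fn =ᵐ[volume] fun v => (s * Real.cos (Real.arctan (s * (v - u))) : ℝ) * F.fn v) ∧
      ‖freeTransport u x‖ ≤ (1 + Real.pi) * ‖F‖ := by
  have abs_deriv_sin_le (x : ℝ) : |deriv Real.sin x| ≤ 1 := by
    simpa using Real.abs_cos_le_one x
  have abs_deriv_cos_le (x : ℝ) : |deriv Real.cos x| ≤ 1 := by
    simpa using Real.abs_sin_le_one x
  have hcos := isMultiplier_comp_arctan Real.contDiff_cos Real.abs_cos_le_one abs_deriv_cos_le u s
  have hsin := isMultiplier_comp_arctan Real.contDiff_sin Real.abs_sin_le_one abs_deriv_sin_le u s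
  have fn_eq : ((s : ℂ) • hcos.mulCLM F).fn =ᵐ[volume] fun v =>
      (s * Real.cos (Real.arctan (s * (v - u))) : ℝ) * F.fn v := by
    filter_upwards [W11.fn_smul s (hcos.mulCLM F), hcos.mulCLM_fn F] with v h_smul h_mul
    rw [h_smul, Pi.smul_apply, h_mul, smul_eq_mul, Complex.ofReal_mul, mul_assoc]
  obtain ⟨x, hx, hAx⟩ := exists_apply_eq (u := u) (F := (s : ℂ) • hcos.mulCLM F)
    (P := hsin.mulCLM F) <| by
      filter_upwards [fn_eq, hsin.mulCLM_fn F] with v h_fn h_mul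
      rw [h_mul, h_fn, Real.sin_arctan, Real.cos_arctan]
      push_cast
      ring
  refine ⟨x, by rwa [hx], ?_⟩
  rw [hAx, norm_smul, Complex.norm_I, one_mul, ← one_mul Real.pi]
  exact norm_mulCLM_comp_arctan_le Real.contDiff_sin Real.abs_sin_le_one abs_deriv_sin_le u hs F

lemma memW11_contDiffBump {u : ℝ} (χ : ContDiffBump u) : MemW11 fun v => (χ v : ℂ) :=
  memW11_of_hasCompactSupport (Complex.ofRealCLM.contDiff.comp χ.contDiff)
    (χ.hasCompactSupport.comp_left Complex.ofReal_zero)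

/- The profiles `v ↦ s χ(v) / √(1 + s² (v - u)²)` have integral at least `arsinh s`, while their
products with `v - u` stay bounded in `W^{1,1}(ℝ)` as `s → ∞`. -/
lemma freeTransport.not_integralCLM_le (u : ℝ) :
    ¬ ∃ C, ∀ x : velocityMul.domain, ‖W11.integralCLM x.1‖ ≤ C * ‖freeTransport u x‖ := by
  rintro ⟨C, hC⟩
  let χ : ContDiffBump u := ⟨1, 2, zero_lt_one, one_lt_two⟩
  set F : W11 := (memW11_contDiffBump χ).toW11 with hF
  have χ_eq_one (v : ℝ) (hv : v ∈ Ioc u (u + 1)) : χ v = 1 := by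
    refine χ.one_of_mem_closedBall ?_
    rw [Real.closedBall_eq_Icc]
    exact ⟨by linarith [hv.1], hv.2⟩
  have arsinh_le (s : ℝ) (hs : 0 < s) : Real.arsinh s ≤ |C| * ((1 + Real.pi) * ‖F‖) := by
    obtain ⟨x, hx, hAx⟩ := exists_fn_eq_cos_arctan_mul u hs F
    calc Real.arsinh s
      _ ≤ ∫ v, s * Real.cos (Real.arctan (s * (v - u))) * χ v :=
          arsinh_le_integral (χ.continuous.integrable_of_hasCompactSupport χ.hasCompactSupport)
            (fun v => χ.nonneg) χ_eq_one hs
      _ ≤ ‖∫ v, x.1.fn v‖ := by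
          rw [integral_congr_ae (g := fun v => ((s * Real.cos (Real.arctan (s * (v - u))) * χ v : ℝ)
            : ℂ)) (hx.trans ?_), integral_complex_ofReal, Complex.norm_real]
          · exact le_abs_self _
          · filter_upwards [(memW11_contDiffBump χ).fn_toW11] with v hv
            rw [hF, hv, Complex.ofReal_mul _ (χ v)]
      _ ≤ |C| * ‖freeTransport u x‖ := (hC x).trans (by gcongr; exact le_abs_self C)
      _ ≤ |C| * ((1 + Real.pi) * ‖F‖) := by gcongr
  have bound_nonneg : 0 ≤ |C| * ((1 + Real.pi) * ‖F‖) := by positivity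
  have := arsinh_le (Real.sinh (|C| * ((1 + Real.pi) * ‖F‖) + 1))
    (Real.sinh_pos_iff.2 (by linarith))
  rw [Real.arsinh_sinh] at this
  linarith

/-! ### Division by `v - u` -/

section Dslope

variable {E : Type*} [NormedAddCommGroup E] [NormedSpace ℝ E] {p : ℝ → E} {u x : ℝ}

lemma norm_dslope_sub_deriv_le {M : ℝ} (hd : ∀ y ∈ uIcc u x, DifferentiableAt ℝ p y)
    (hM : ∀ y ∈ uIcc u x, ‖deriv p y - deriv p u‖ ≤ M) :
    ‖dslope p u x - deriv p u‖ ≤ M := by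
  rcases eq_or_ne x u with rfl | hx
  · simpa using hM x left_mem_uIcc
  have sub_ne_zero : x - u ≠ 0 := sub_ne_zero.2 hx
  have mean_value := (convex_uIcc u x).norm_image_sub_le_of_norm_hasDerivWithin_le
    (f := fun y => p y - y • deriv p u) (f' := fun y => deriv p y - deriv p u)
    (fun y hy => by simpa using ((hd y hy).hasDerivAt.fun_sub
      ((hasDerivAt_id y).smul_const (deriv p u))).hasDerivWithinAt)
    hM left_mem_uIcc right_mem_uIcc
  have sub_eq : p x - x • deriv p u - (p u - u • deriv p u) =
      (x - u) • (dslope p u x - deriv p u) := by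
    rw [smul_sub, sub_smul_dslope, sub_smul]
    abel
  rw [sub_eq, norm_smul, mul_comm M] at mean_value
  exact le_of_mul_le_mul_left mean_value (norm_pos_iff.2 sub_ne_zero)

lemma hasDerivAt_dslope (hx : x ≠ u) (hd : DifferentiableAt ℝ p x) :
    HasDerivAt (dslope p u) ((x - u)⁻¹ • (deriv p x - dslope p u x)) x := by
  have sub_ne_zero : x - u ≠ 0 := sub_ne_zero.2 hx
  have hq := ((differentiableAt_dslope_of_ne hx).2 hd).hasDerivAt
  have key : HasDerivAt p ((x - u) • deriv (dslope p u) x + dslope p u x) x := by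
    have h := (((hasDerivAt_id x).sub_const u).smul hq).add_const (p u)
    refine (h.congr_deriv (by simp)).congr_of_eventuallyEq (Eventually.of_forall fun y => ?_)
    simp
  refine hq.congr_deriv ?_
  rw [key.deriv, add_sub_cancel_right, inv_smul_smul₀ sub_ne_zero]

lemma norm_deriv_dslope_le {C α : ℝ} (hα : 0 ≤ α) (hx : x ≠ u)
    (hd : ∀ y ∈ uIcc u x, DifferentiableAt ℝ p y)
    (hC : ∀ y ∈ uIcc u x, ‖deriv p y - deriv p u‖ ≤ C * |y - u| ^ α) :
    ‖deriv (dslope p u) x‖ ≤ 2 * C * |x - u| ^ (α - 1) := by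
  have abs_pos : 0 < |x - u| := abs_pos.2 (sub_ne_zero.2 hx)
  have C_nonneg : 0 ≤ C := nonneg_of_mul_nonneg_left
    ((norm_nonneg _).trans (hC x right_mem_uIcc)) (Real.rpow_pos_of_pos abs_pos α)
  have norm_dslope := norm_dslope_sub_deriv_le hd fun y hy => (hC y hy).trans <|
    mul_le_mul_of_nonneg_left
      (Real.rpow_le_rpow (abs_nonneg _) (abs_sub_left_of_mem_uIcc hy) hα) C_nonneg
  rw [(hasDerivAt_dslope hx (hd x right_mem_uIcc)).deriv, norm_smul, norm_inv, Real.norm_eq_abs,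
    inv_mul_le_iff₀ abs_pos]
  calc ‖deriv p x - dslope p u x‖
    _ ≤ C * |x - u| ^ α + C * |x - u| ^ α :=
        (norm_sub_le_norm_sub_add_norm_sub _ (deriv p u) _).trans
          (add_le_add (hC x right_mem_uIcc) (by rwa [norm_sub_rev]))
    _ = |x - u| * (2 * C * |x - u| ^ (α - 1)) := by
        rw [Real.rpow_sub_one abs_pos.ne']
        field_simp
        ring

end Dslope

lemma integrableOn_abs_sub_rpow {r : ℝ} (hr : -1 < r) (u δ : ℝ) :
    IntegrableOn (fun x => |x - u| ^ r) (Metric.closedBall u δ) := by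
  have locallyIntegrable : LocallyIntegrable (fun x : ℝ => |x| ^ r) :=
    locallyIntegrable_of_norm_le_rpow (α := -r) (C := 1) (by simp) (by simp; linarith)
      (Eventually.of_forall fun x => by
        simp [abs_of_nonneg (Real.rpow_nonneg (abs_nonneg x) r)])
      (by apply Measurable.aestronglyMeasurable; fun_prop)
  have integrableOn := locallyIntegrable.integrableOn_isCompact (isCompact_closedBall 0 δ)
  rw [← (measurePreserving_sub_right volume u).integrableOn_comp_preimage
    (measurableEmbedding_subRight u)] at integrableOn
  have preimage_eq : (fun x => x - u) ⁻¹' Metric.closedBall 0 δ = Metric.closedBall u δ := by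
    ext x
    simp [Real.dist_eq]
  rwa [preimage_eq] at integrableOn

/-- `p` is differentiable near `u` and its derivative is Hölder continuous at `u`. -/
def HolderC1At (p : ℝ → ℂ) (u : ℝ) : Prop :=
  (∀ᶠ v in 𝓝 u, DifferentiableAt ℝ p v) ∧ ∃ α > (0 : ℝ), ∃ C : ℝ, ∀ᶠ v in 𝓝 u,
    ‖deriv p v - deriv p u‖ ≤ C * |v - u| ^ α

lemma HolderC1At.exists_integrableOn_deriv_dslope {p : ℝ → ℂ} {u : ℝ} (h : HolderC1At p u) :
    ∃ δ > 0, (∀ x ∈ Metric.closedBall u δ, DifferentiableAt ℝ p x) ∧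
      IntegrableOn (deriv (dslope p u)) (Metric.closedBall u δ) := by
  obtain ⟨hd, α, hα, C, hC⟩ := h
  obtain ⟨δ, hδ, hball⟩ := Metric.nhds_basis_closedBall.eventually_iff.1 (hd.and hC)
  refine ⟨δ, hδ, fun x hx => (hball hx).1, ?_⟩
  refine ((integrableOn_abs_sub_rpow (r := α - 1) (by linarith) u δ).const_mul (2 * C)).mono'
    (aestronglyMeasurable_deriv _ _) ?_
  filter_upwards [ae_restrict_mem measurableSet_closedBall,
    ae_restrict_of_ae (Measure.ae_ne volume u)] with x hx hxu
  have uIcc_subset : uIcc u x ⊆ Metric.closedBall u δ := by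
    rw [← segment_eq_uIcc]
    exact (convex_closedBall u δ).segment_subset (Metric.mem_closedBall_self hδ.le) hx
  exact norm_deriv_dslope_le hα.le hxu (fun y hy => (hball (uIcc_subset hy)).1)
    fun y hy => (hball (uIcc_subset hy)).2

lemma memW11_smul_of_integrableOn_deriv {χ : ℝ → ℝ} (hχ : ContDiff ℝ 1 χ)
    (hc : HasCompactSupport χ) {q : ℝ → ℂ} (hq : Continuous q) {s : Set ℝ} (hs : s.Countable)
    (hd : ∀ x ∈ tsupport χ \ s, DifferentiableAt ℝ q x)
    (hi : IntegrableOn (deriv q) (tsupport χ)) : MemW11 fun x => χ x • q x := by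
  have integrable_smul_deriv : Integrable fun x => χ x • deriv q x := by
    obtain ⟨A, hA⟩ := hχ.continuous.bounded_above_of_compact_support hc
    refine (integrableOn_iff_integrable_of_support_subset (s := tsupport χ) fun x hx => ?_).1
      (hi.bdd_smul A hχ.continuous.aestronglyMeasurable (Eventually.of_forall hA))
    exact subset_tsupport χ (left_ne_zero_of_smul hx)
  have integrable_deriv_smul : Integrable fun x => deriv χ x • q x :=
    ((hχ.continuous_deriv le_rfl).smul hq).integrable_of_hasCompactSupport hc.deriv.smul_right
  have hasDerivAt (x : ℝ) (hx : x ∉ s) :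
      HasDerivAt (fun x => χ x • q x) (χ x • deriv q x + deriv χ x • q x) x := by
    by_cases hxχ : x ∈ tsupport χ
    · exact (hχ.differentiable one_ne_zero x).hasDerivAt.smul (hd x ⟨hxχ, hx⟩).hasDerivAt
    · have χ_eq_zero := notMem_tsupport_iff_eventuallyEq.1 hxχ
      rw [χ_eq_zero.deriv_eq, χ_eq_zero.eq_of_nhds]
      refine ((hasDerivAt_const x (0 : ℂ)).congr_of_eventuallyEq ?_).congr_deriv (by simp)
      filter_upwards [χ_eq_zero] with y hy
      simp [hy]
  have integrable := integrable_smul_deriv.add integrable_deriv_smul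
  exact ⟨(hχ.continuous.smul hq).integrable_of_hasCompactSupport hc.smul_right, _, integrable,
    .of_hasDerivAt_off_countable hs (hχ.continuous.smul hq) hasDerivAt integrable⟩

lemma IsMultiplier.inv_sub_mul {φ : ℝ → ℂ} (hφ : IsMultiplier φ) {u r : ℝ} (hr : 0 < r)
    (h : ∀ v ∈ Metric.ball u r, φ v = 0) :
    IsMultiplier fun v : ℝ => ((v : ℂ) - u)⁻¹ * φ v := by
  set ψ := fun v : ℝ => ((v : ℂ) - u)⁻¹ * φ v
  have eventuallyEq_zero (v : ℝ) (hv : v ∈ Metric.ball u r) : ψ =ᶠ[𝓝 v] fun _ => 0 := by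
    filter_upwards [Metric.isOpen_ball.mem_nhds hv] with w hw
    simp [ψ, h w hw]
  have le_norm_sub (v : ℝ) (hv : v ∉ Metric.ball u r) : r ≤ ‖(v : ℂ) - u‖ := by
    rw [← Complex.ofReal_sub, Complex.norm_real, ← dist_eq_norm]
    simpa using hv
  have sub_ne_zero (v : ℝ) (hv : v ∉ Metric.ball u r) : (v : ℂ) - u ≠ 0 :=
    norm_pos_iff.1 (hr.trans_le (le_norm_sub v hv))
  have norm_inv_le (v : ℝ) (hv : v ∉ Metric.ball u r) : ‖((v : ℂ) - u)⁻¹‖ ≤ r⁻¹ := by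
    rw [norm_inv]
    exact inv_anti₀ hr (le_norm_sub v hv)
  obtain ⟨⟨A, hA⟩, ⟨B, hB⟩⟩ := hφ.bounded, hφ.bounded_deriv
  have A_nonneg : 0 ≤ A := (norm_nonneg _).trans (hA u)
  have B_nonneg : 0 ≤ B := (norm_nonneg _).trans (hB u)
  refine ⟨contDiff_iff_contDiffAt.2 fun v => ?_, ⟨r⁻¹ * A, fun v => ?_⟩,
    ⟨r⁻¹ ^ 2 * A + r⁻¹ * B, fun v => ?_⟩⟩ <;>
  by_cases hv : v ∈ Metric.ball u r
  · exact contDiffAt_const.congr_of_eventuallyEq (eventuallyEq_zero v hv)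
  · exact ((Complex.ofRealCLM.contDiff.sub contDiff_const).contDiffAt.inv
      (sub_ne_zero v hv)).mul hφ.contDiff.contDiffAt
  · rw [(eventuallyEq_zero v hv).eq_of_nhds, norm_zero]
    positivity
  · exact norm_mul_le_of_le (norm_inv_le v hv) (hA v)
  · rw [(eventuallyEq_zero v hv).deriv_eq, deriv_const, norm_zero]
    positivity
  · rw [((hasDerivAt_inv_sub (sub_ne_zero v hv)).fun_mul (hφ.hasDerivAt v)).deriv]
    refine norm_add_le_of_le (norm_mul_le_of_le ?_ (hA v))
      (norm_mul_le_of_le (norm_inv_le v hv) (hB v))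
    rw [norm_neg, norm_pow]
    exact pow_le_pow_left₀ (norm_nonneg _) (norm_inv_le v hv) 2

lemma isMultiplier_one_sub_contDiffBump {u : ℝ} (χ : ContDiffBump u) :
    IsMultiplier fun v : ℝ => (1 - χ v : ℂ) := by
  have hasDerivAt (v : ℝ) : HasDerivAt (fun v => (1 - χ v : ℂ)) (-((deriv χ v : ℝ) : ℂ)) v :=
    (χ.contDiff.differentiable (n := 1) one_ne_zero v).hasDerivAt.ofReal_comp.const_sub 1
  obtain ⟨B, hB⟩ := (χ.contDiff (n := 1).continuous_deriv le_rfl).bounded_above_of_compact_support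
    χ.hasCompactSupport.deriv
  refine ⟨contDiff_const.sub (Complex.ofRealCLM.contDiff.comp χ.contDiff), ⟨1, fun v => ?_⟩,
    ⟨B, fun v => ?_⟩⟩
  · rw [← Complex.ofReal_one, ← Complex.ofReal_sub, Complex.norm_real, Real.norm_eq_abs, abs_le]
    constructor <;> linarith [χ.nonneg (x := v), χ.le_one (x := v)]
  · rw [(hasDerivAt v).deriv, norm_neg, Complex.norm_real]
    exact hB v

lemma eq_zero_of_integrable_div_sub {p : ℝ → ℂ} {u : ℝ} (hp : ContinuousAt p u)
    (h : Integrable fun v : ℝ => p v / ((v : ℂ) - u)) : p u = 0 := by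
  by_contra hne
  have one_isBigO : (fun _ => (1 : ℝ)) =O[𝓝 u] p :=
    (Asymptotics.isBigO_const_left_iff_pos_le_norm one_ne_zero).2
      ⟨‖p u‖ / 2, by positivity, hp.norm.eventually_const_le (half_lt_self (by positivity))⟩
  refine not_intervalIntegrable_of_sub_inv_isBigO_punctured (c := u) (a := u) (b := u + 1)
    ?_ (by simp) (by simp) h.intervalIntegrable
  have inv_isBigO : (fun v : ℝ => (v - u)⁻¹) =O[𝓝[≠] u] fun v : ℝ => ((v : ℂ) - u)⁻¹ :=
    Asymptotics.isBigO_of_le _ fun v => by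
      rw [← Complex.ofReal_sub, ← Complex.ofReal_inv, Complex.norm_real]
  simpa [div_eq_mul_inv] using (one_isBigO.mono nhdsWithin_le_nhds).mul inv_isBigO

lemma HolderC1At.memW11_div_sub {p : ℝ → ℂ} {u : ℝ} (h : HolderC1At p u) (hp : Continuous p)
    (hW : MemW11 p) (hi : Integrable fun v : ℝ => p v / ((v : ℂ) - u)) :
    MemW11 fun v : ℝ => p v / ((v : ℂ) - u) := by
  obtain ⟨δ, hδ, hd, hq⟩ := h.exists_integrableOn_deriv_dslope
  let χ : ContDiffBump u := ⟨δ / 2, δ, half_pos hδ, half_lt_self hδ⟩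
  have tsupport_eq : tsupport χ = Metric.closedBall u δ := χ.tsupport_eq
  have continuous_dslope : Continuous (dslope p u) := continuousOn_univ.1 <|
    (continuousOn_dslope univ_mem).2 ⟨hp.continuousOn, hd u (Metric.mem_closedBall_self hδ.le)⟩
  have near : MemW11 fun v => χ v • dslope p u v :=
    memW11_smul_of_integrableOn_deriv χ.contDiff χ.hasCompactSupport continuous_dslope
      (countable_singleton u)
      (fun x hx => (differentiableAt_dslope_of_ne hx.2).2 (hd x (tsupport_eq ▸ hx.1)))
      (tsupport_eq ▸ hq)
  have away : MemW11 fun v : ℝ => ((v : ℂ) - u)⁻¹ * (1 - χ v) * p v :=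
    ((isMultiplier_one_sub_contDiffBump χ).inv_sub_mul χ.rIn_pos fun v hv => by
      simp [χ.one_of_mem_closedBall (Metric.ball_subset_closedBall hv)]).memW11_mul hW
  refine (near.add away).congr ?_
  filter_upwards [Measure.ae_ne volume u] with v hv
  have dslope_eq : dslope p u v = p v / ((v : ℂ) - u) := by
    rw [dslope_of_ne _ hv, slope_def_module, eq_zero_of_integrable_div_sub hp.continuousAt hi,
      sub_zero, Complex.real_smul, Complex.ofReal_inv, Complex.ofReal_sub, div_eq_inv_mul]
  rw [Pi.add_apply, dslope_eq, Complex.real_smul]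
  ring

/-! ### The spectrum of the Vlasov operator -/

section RealFrequency

variable {k : ℝ} {g : W11} {u : ℝ}

lemma W11.evalCLM_ne_zero (u : ℝ) : W11.evalCLM u ≠ 0 := by
  intro h
  let χ : ContDiffBump u := ⟨1, 2, zero_lt_one, one_lt_two⟩
  have rep_eq : (memW11_contDiffBump χ).toW11.rep = fun v => (χ v : ℂ) :=
    W11.rep_eq (memW11_contDiffBump χ).fn_toW11 (Complex.continuous_ofReal.comp χ.continuous)
  have eval_eq_zero : (memW11_contDiffBump χ).toW11.rep u = 0 :=
    DFunLike.congr_fun h (memW11_contDiffBump χ).toW11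
  simp [rep_eq, χ.one_of_mem_closedBall (Metric.mem_closedBall_self χ.rIn_pos.le)] at eval_eq_zero

lemma dense_range_shifted_iff (hk : k ≠ 0) :
    Dense (range (shifted (vlasovOperator k g) (Complex.I * u))) ↔ g.rep u ≠ 0 := by
  rw [shifted_vlasovOperator]
  have eval_smul : W11.evalCLM u ((Complex.I * ((k : ℂ) ^ 2)⁻¹) • g) =
      Complex.I * ((k : ℂ) ^ 2)⁻¹ * g.rep u := map_smul _ _ _
  refine ⟨fun hd hg => ?_, fun hg => ?_⟩
  · exact not_dense_range_sub_smulRight (freeTransport.evalCLM_apply u)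
      (by rw [eval_smul, hg, mul_zero]) (W11.evalCLM_ne_zero u) hd
  · exact dense_range_sub_smulRight (freeTransport.not_integralCLM_le u)
      (fun _ => freeTransport.mem_closure_range) (by rw [eval_smul]; simp [hk, hg])

lemma not_boundedBelow_shifted (k : ℝ) (g : W11) (u : ℝ) :
    ¬ ∃ C, ∀ x : (vlasovOperator k g).domain,
      ‖(x : W11)‖ ≤ C * ‖shifted (vlasovOperator k g) (Complex.I * u) x‖ := by
  rw [shifted_vlasovOperator]
  refine not_boundedBelow_sub_smulRight (freeTransport.not_integralCLM_le u) fun δ hδ =>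
    ⟨(δ / 2)⁻¹, fun x => (norm_integralCLM_le u (half_pos hδ) x).trans_eq ?_⟩
  rw [mul_div_cancel₀ δ two_ne_zero]
  rfl

lemma mem_continuousSpectrum_iff (hk : k ≠ 0) :
    Complex.I * u ∈ continuousSpectrum (vlasovOperator k g) ↔
      Complex.I * u ∉ pointSpectrum (vlasovOperator k g) ∧ g.rep u ≠ 0 :=
  and_congr not_not.symm <| (and_iff_left (not_boundedBelow_shifted k g u)).trans
    (dense_range_shifted_iff hk)

lemma mem_residualSpectrum_iff (hk : k ≠ 0) :
    Complex.I * u ∈ residualSpectrum (vlasovOperator k g) ↔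
      Complex.I * u ∉ pointSpectrum (vlasovOperator k g) ∧ g.rep u = 0 :=
  and_congr not_not.symm <| (dense_range_shifted_iff hk).not_left

end RealFrequency

section Spectrum

variable {k : ℝ} {g : W11} {z : ℂ}

lemma exists_eq_I_mul (z : ℂ) : ∃ u, z = Complex.I * u :=
  ⟨-Complex.I * z, by rw [← mul_assoc]; simp⟩

lemma exists_real_of_mem_spectrum (hz : z ∈ spectrum (vlasovOperator k g))
    (hp : z ∉ pointSpectrum (vlasovOperator k g)) : ∃ u : ℝ, z = Complex.I * u := by
  obtain ⟨u, rfl⟩ := exists_eq_I_mul z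
  suffices u.im = 0 from ⟨u.re, congrArg _ (Complex.ext rfl this)⟩
  by_contra hu
  have injective := not_not.1 hp
  refine notMem_spectrum_iff.2 ?_ hz
  rw [shifted_vlasovOperator] at injective ⊢
  exact (freeTransport.isBoundedInverse hu).exists_sub_smulRight injective

theorem spectrum_eq_union (hk : k ≠ 0) : spectrum (vlasovOperator k g) =
    pointSpectrum (vlasovOperator k g) ∪ continuousSpectrum (vlasovOperator k g) ∪
      residualSpectrum (vlasovOperator k g) := by
  refine subset_antisymm (fun z hz => ?_) (union_subset_spectrum _)
  by_cases hp : z ∈ pointSpectrum (vlasovOperator k g)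
  · exact .inl (.inl hp)
  obtain ⟨u, rfl⟩ := exists_real_of_mem_spectrum hz hp
  rcases eq_or_ne (g.rep u) 0 with hg | hg
  · exact .inr ((mem_residualSpectrum_iff hk).2 ⟨hp, hg⟩)
  · exact .inl (.inr ((mem_continuousSpectrum_iff hk).2 ⟨hp, hg⟩))

theorem continuousSpectrum_eq (hk : k ≠ 0) : continuousSpectrum (vlasovOperator k g) =
    {z | ∃ u : ℝ, z = Complex.I * u ∧ z ∉ pointSpectrum (vlasovOperator k g) ∧ g.rep u ≠ 0} := by
  ext z
  refine ⟨fun hz => ?_, ?_⟩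
  · obtain ⟨u, rfl⟩ := exists_real_of_mem_spectrum
      (union_subset_spectrum _ (.inl (.inr hz))) (not_not.2 hz.1)
    exact ⟨u, rfl, (mem_continuousSpectrum_iff hk).1 hz⟩
  · rintro ⟨u, rfl, h⟩
    exact (mem_continuousSpectrum_iff hk).2 h

theorem residualSpectrum_eq (hk : k ≠ 0) : residualSpectrum (vlasovOperator k g) =
    {z | ∃ u : ℝ, z = Complex.I * u ∧ z ∉ pointSpectrum (vlasovOperator k g) ∧ g.rep u = 0} := by
  ext z
  refine ⟨fun hz => ?_, ?_⟩
  · obtain ⟨u, rfl⟩ := exists_real_of_mem_spectrum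
      (union_subset_spectrum _ (.inr hz)) (not_not.2 hz.1)
    exact ⟨u, rfl, (mem_residualSpectrum_iff hk).1 hz⟩
  · rintro ⟨u, rfl, h⟩
    exact (mem_residualSpectrum_iff hk).2 h

end Spectrum

section Dispersion

variable {k : ℝ} {p : ℝ → ℂ} {u : ℂ}

/-- The dispersion relation `1 - k⁻² ∫ p(v) / (v - u) dv = 0` for a complex-valued profile `p`,
including the convergence of the integral; `DispersionRelation k f₀ u` is the case `p = f₀'`. -/
def IsDispersionRoot (k : ℝ) (p : ℝ → ℂ) (u : ℂ) : Prop :=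
  Integrable (fun v : ℝ => p v / ((v : ℂ) - u)) ∧
    1 - ((k : ℂ) ^ 2)⁻¹ * ∫ v : ℝ, p v / ((v : ℂ) - u) = 0

lemma mem_pointSpectrum_iff_exists {g : W11} :
    Complex.I * u ∈ pointSpectrum (vlasovOperator k g) ↔ ∃ x : velocityMul.domain,
      freeTransport u x = (Complex.I * ((k : ℂ) ^ 2)⁻¹) • g ∧ W11.integralCLM x.1 = 1 := by
  change ¬ Function.Injective _ ↔ _
  rw [shifted_vlasovOperator]
  exact (not_congr (injective_sub_smulRight_iff freeTransport.injective)).trans not_not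

lemma mem_pointSpectrum_iff (hp : MemW11 p) :
    Complex.I * u ∈ pointSpectrum (vlasovOperator k hp.toW11) ↔
      IsDispersionRoot k p u ∧ MemW11 fun v : ℝ => p v / ((v : ℂ) - u) := by
  set κ : ℂ := ((k : ℂ) ^ 2)⁻¹
  have ae_sub_ne_zero : ∀ᵐ v : ℝ, (v : ℂ) - u ≠ 0 := by
    filter_upwards [Measure.ae_ne volume u.re] with v hv h
    exact hv (by simpa [sub_eq_zero] using congrArg Complex.re h)
  rw [mem_pointSpectrum_iff_exists]
  refine ⟨fun ⟨x, hx, integral_eq⟩ => ?_, fun ⟨hr, hW⟩ => ?_⟩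
  · have fn_eq : x.1.fn =ᵐ[volume] fun v : ℝ => κ * (p v / ((v : ℂ) - u)) := by
      have h := freeTransport.fn_apply (u := u) x
      rw [hx] at h
      filter_upwards [h, W11.fn_smul (Complex.I * κ) hp.toW11, hp.fn_toW11, ae_sub_ne_zero]
        with v h_fn h_smul h_p hv
      rw [h_smul, Pi.smul_apply, h_p, smul_eq_mul, mul_assoc] at h_fn
      rw [← mul_div_assoc, mul_left_cancel₀ Complex.I_ne_zero h_fn, mul_div_cancel_left₀ _ hv]
    have κ_mul_integral : κ * ∫ v : ℝ, p v / ((v : ℂ) - u) = 1 := by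
      rw [← integral_const_mul, ← integral_congr_ae fn_eq]
      exact integral_eq
    have memW11 : MemW11 fun v : ℝ => p v / ((v : ℂ) - u) := by
      refine (x.1.memW11.const_smul κ⁻¹).congr ?_
      filter_upwards [fn_eq] with v hv
      rw [Pi.smul_apply, hv, smul_eq_mul,
        inv_mul_cancel_left₀ (left_ne_zero_of_mul_eq_one κ_mul_integral)]
    exact ⟨⟨memW11.1, sub_eq_zero.2 κ_mul_integral.symm⟩, memW11⟩
  · obtain ⟨x, hx, h⟩ := freeTransport.exists_apply_eq (u := u) (F := hW.toW11)
        (P := hp.toW11) <| by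
      filter_upwards [hp.fn_toW11, hW.fn_toW11, ae_sub_ne_zero] with v h_p h_q hv
      rw [h_p, h_q, mul_div_cancel₀ _ hv]
    refine ⟨κ • x, by rw [map_smul, h, smul_smul, mul_comm], ?_⟩
    change W11.integralCLM (κ • x.1) = 1
    rw [map_smul, hx, smul_eq_mul]
    change κ * ∫ v, hW.toW11.fn v = 1
    rw [integral_congr_ae hW.fn_toW11]
    exact (sub_eq_zero.1 hr.2).symm

lemma memW11_div_sub_of_im_ne_zero (hp : MemW11 p) (hu : u.im ≠ 0) :
    MemW11 fun v : ℝ => p v / ((v : ℂ) - u) := by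
  simpa only [div_eq_inv_mul] using (isMultiplier_inv_sub hu).memW11_mul hp

lemma IsDispersionRoot.mem_pointSpectrum (hr : IsDispersionRoot k p u) (hp : MemW11 p)
    (hpc : Continuous p) (hu : u.im = 0 → HolderC1At p u.re) :
    Complex.I * u ∈ pointSpectrum (vlasovOperator k hp.toW11) := by
  refine (mem_pointSpectrum_iff hp).2 ⟨hr, ?_⟩
  by_cases him : u.im = 0
  · obtain ⟨u, rfl⟩ : ∃ r : ℝ, u = r := ⟨u.re, Complex.ext rfl him⟩
    exact (hu him).memW11_div_sub hpc hp hr.1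
  · exact memW11_div_sub_of_im_ne_zero hp him

lemma HolderC2At.holderC1At_deriv {f₀ : ℝ → ℝ} {u : ℝ} (h : HolderC2At f₀ u) :
    HolderC1At (fun v => ((deriv f₀ v : ℝ) : ℂ)) u := by
  obtain ⟨contDiffAt, α, hα, C, hC⟩ := h
  have differentiable : ∀ᶠ v in 𝓝 u, DifferentiableAt ℝ (deriv f₀) v := by
    filter_upwards [contDiffAt.eventually (by simp)] with v hv
    exact (hv.derivWithin (m := 1) (by norm_num)).differentiableAt (by simp)
  have deriv_eq (v : ℝ) (hv : DifferentiableAt ℝ (deriv f₀) v) :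
      deriv (fun v => ((deriv f₀ v : ℝ) : ℂ)) v = ((deriv (deriv f₀) v : ℝ) : ℂ) :=
    hv.hasDerivAt.ofReal_comp.deriv
  refine ⟨differentiable.mono fun v hv => hv.hasDerivAt.ofReal_comp.differentiableAt,
    α, hα, C, ?_⟩
  filter_upwards [differentiable, hC] with v hv hCv
  rwa [deriv_eq v hv, deriv_eq u differentiable.self_of_nhds, ← Complex.ofReal_sub,
    Complex.norm_real]

end Dispersion

end Vlasov

end


open Vlasov in
theorem mainTheorem6_general {k : ℝ} (hk : k ≠ 0) {p : ℝ → ℂ} (hp : Continuous p)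
    (hW : MemW11 p) :
    let T := vlasovOperator k hW.toW11
    spectrum T = pointSpectrum T ∪ continuousSpectrum T ∪ residualSpectrum T ∧
    (∀ z ∈ pointSpectrum T, ∃ u : ℂ, z = Complex.I * u ∧ IsDispersionRoot k p u) ∧
    (∀ u : ℂ, (u.im = 0 → HolderC1At p u.re) → IsDispersionRoot k p u →
      Complex.I * u ∈ pointSpectrum T) ∧
    continuousSpectrum T = {z : ℂ | ∃ u : ℝ, z = Complex.I * u ∧ z ∉ pointSpectrum T ∧ p u ≠ 0} ∧
    residualSpectrum T = {z : ℂ | ∃ u : ℝ, z = Complex.I * u ∧ z ∉ pointSpectrum T ∧ p u = 0} := by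
  intro T
  have rep_eq : hW.toW11.rep = p := W11.rep_eq hW.fn_toW11 hp
  refine ⟨spectrum_eq_union hk, fun z hz => ?_, fun u hu hr => hr.mem_pointSpectrum hW hp hu,
    by rw [continuousSpectrum_eq hk, rep_eq], by rw [residualSpectrum_eq hk, rep_eq]⟩
  obtain ⟨u, rfl⟩ := exists_eq_I_mul z
  exact ⟨u, rfl, ((mem_pointSpectrum_iff hW).1 hz).1⟩

theorem mainTheorem6 (k : ℝ) (hk : 0 < k) (f₀ : ℝ → ℝ) (hf₀ : ContDiff ℝ 1 f₀)
    (hW : Vlasov.MemW11 fun v : ℝ => ((deriv f₀ v : ℝ) : ℂ)) :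
    let T := Vlasov.vlasovOperator k hW.toW11
    -- the spectrum is the union of its three parts
    Vlasov.spectrum T =
      Vlasov.pointSpectrum T ∪ Vlasov.continuousSpectrum T ∪ Vlasov.residualSpectrum T ∧
    -- every point of the point spectrum solves the dispersion relation
    (∀ z ∈ Vlasov.pointSpectrum T, ∃ u : ℂ, z = Complex.I * u ∧
      Vlasov.DispersionRelation k f₀ u) ∧
    -- every solution is in the point spectrum (for real `u`: if `f₀` is regular enough at `u`)
    (∀ u : ℂ, (u.im = 0 → Vlasov.HolderC2At f₀ u.re) → Vlasov.DispersionRelation k f₀ u →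
      Complex.I * u ∈ Vlasov.pointSpectrum T) ∧
    Vlasov.continuousSpectrum T = {z : ℂ | ∃ u : ℝ, z = Complex.I * u ∧
      z ∉ Vlasov.pointSpectrum T ∧ deriv f₀ u ≠ 0} ∧
    Vlasov.residualSpectrum T = {z : ℂ | ∃ u : ℝ, z = Complex.I * u ∧
      z ∉ Vlasov.pointSpectrum T ∧ deriv f₀ u = 0} := by
  obtain ⟨union, dispersion, point, continuous, residual⟩ :=
    mainTheorem6_general hk.ne' (Complex.continuous_ofReal.comp (hf₀.continuous_deriv le_rfl)) hW
  exact ⟨union, dispersion, fun u hu => point u fun h => (hu h).holderC1At_deriv,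
    by simpa using continuous, by simpa using residual⟩
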